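/- Consider an aggregative game with players $i\in\{1,\dots,N\}$ and strategies $x_i\in\mathbb R^n$, with continuously differentiable functions $J_i:\mathbb R^n\times\mathbb R^n\to\mathbb R$, so that player $i$'s payoff is $J_i(x_i,\sigma(x))$ with the aggregator $\sigma(x)=\sum_{i=1}^N\beta_ix_i$, whose weights $\beta=(\beta_1,\dots,\beta_N)\in\mathbb R^N$ are unknown. For candidate weights $\beta$ let $F(x;\beta)=(F_1(x;\beta),\dots,F_N(x;\beta))$, $F_i(x;\beta)=\nabla_{x_i}J_i(\cdot,\sigma(x))\big|_{x_i}+\beta_i\nabla_\sigma J_i(x_i,\cdot)\big|_{\sigma(x)}$, be the pseudo-gradient. Let $b\in\mathbb R$, and let the parameter $\alpha=(\alpha_1,\dots,\alpha_N)$, $\alpha_i\in\mathbb R^n$, range over the polyhedral uncertainty set $\mathrm A=\prod_{i=1}^N\{\alpha_i\in\mathbb R^n: D_i\alpha_i\le d_i\}$. Let $\alpha\mapsto x^*_\alpha\in\mathbb R^{Nn}$ be a measurable map (the output of an equilibrium solver for the parameter $\alpha$; the equilibrium may be computed exactly or not). Put $$\mathcal X(\alpha,x)=\Big\{(\beta,\delta)\in\mathbb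 R^N\times\mathbb R:\ \exists\,\gamma\le 0,\ F(x;\beta)^Tx-\gamma b\le\delta,\ \ F_i(x;\beta)-\gamma\alpha_i\ge 0\ \text{ for all } i\Big\}.$$ Assume that 1. for every $\alpha\in\mathrm A$ the set $\Omega_\alpha=\{x\in\mathbb R^{Nn}_+:\sum_{i=1}^N\alpha_i^Tx_i\le b\}$ has nonempty interior; 2. for every $\alpha\in\mathrm A$ the set $\mathcal X(\alpha,x^*_\alpha)$ is a convex subset of $\mathbb R^N\times\mathbb R$. Let $\mathbb Q$ be any probability distribution with $\mathbb Q(\mathrm A)=1$, let $\alpha[1],\dots,\alpha[M]$ be i.i.d. samples from $\mathbb Q$, and consider the data-driven inverse problem $$\min_{\beta\in\mathbb R^N,\ \gamma,\eta\in\mathbb R^M}\ \|\eta\|_\infty\quad\text{s.t.}\quad F(x^*_{\alpha[k]};\beta)^Tx^*_{\alpha[k]}-\gamma[k]b\le\eta[k],\quad F_i(x^*_{\alpha[k]};\beta)-\gamma[k]\alpha_i[k]\ge0\ \ \forall i,\quad \gamma[k]\le 0,\qquad k=1,\dots,M.$$ Assume that, for almost every sample, this problem has an optimal solution. Let $\delta^*$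 be its optimal value and let $\beta^*$ be the weight vector of least Euclidean norm among all optimal solutions. For given $(\beta,\delta)$ let $\mathbb V(\beta,\delta)=\mathbb Q\{\alpha\in\mathrm A:(\beta,\delta)\notin\mathcal X(\alpha,x^*_\alpha)\}$ be the violation probability. Then for every $\epsilon\in(0,1)$ $$\mathbb Q^M\big\{(\alpha[1],\dots,\alpha[M]):\ \mathbb V(\beta^*,\delta^*)>\epsilon\big\}\ \le\ \sum_{l=0}^N\binom Ml\epsilon^l(1-\epsilon)^{M-l}.$$ -/

import Mathlib

open MeasureTheory

/-- The strategy space `ℝⁿ` of one player, also the space of one block `αᵢ` of the parameter. -/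
abbrev Vec (n : ℕ) : Type := EuclideanSpace ℝ (Fin n)

/-- Strategy profiles `x = (x₁, …, x_N)`, and parameters `α = (α₁, …, α_N)`, in `ℝ^{Nn}`. -/
abbrev Profile (N n : ℕ) : Type := Fin N → Vec n

/-- Weight vectors `β = (β₁, …, β_N)`, with the Euclidean norm. -/
abbrev Weights (N : ℕ) : Type := EuclideanSpace ℝ (Fin N)

/-- The publicly known data of an `N`-player aggregative game with strategies in `ℝⁿ`: continuously
differentiable functions `Jᵢ(xᵢ, σ)`, the resource level `b`, and, for each player, the
inequalities `Dᵢ αᵢ ≤ dᵢ` that describe the uncertainty of `αᵢ`. The weights `β` of the aggregator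
are not part of it: they are to be learned. -/
structure AggregativeGame (N n : ℕ) where
  /-- the functions `Jᵢ(xᵢ, σ)` -/
  J : Fin N → Vec n → Vec n → ℝ
  /-- each `Jᵢ` is jointly continuously differentiable -/
  contDiff_J : ∀ i, ContDiff ℝ 1 (fun p : Vec n × Vec n => J i p.1 p.2)
  /-- the right-hand side of the coupling constraint -/
  b : ℝ
  /-- the number of inequalities that bound `αᵢ` -/
  m : Fin N → ℕ
  /-- the matrices `Dᵢ` -/
  D : (i : Fin N) → Matrix (Fin (m i)) (Fin n) ℝ
  /-- the vectors `dᵢ` -/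
  d : (i : Fin N) → Fin (m i) → ℝ

namespace AggregativeGame

variable {N n : ℕ}

/-- The uncertainty set `A = ∏ᵢ Aᵢ` with `Aᵢ = {αᵢ | Dᵢ αᵢ ≤ dᵢ}`. -/
def uncertainty (G : AggregativeGame N n) : Set (Profile N n) :=
  {α | ∀ i, ∀ r, ∑ l, G.D i r l * α i l ≤ G.d i r}

/-- The coupling constraint set `Ω_α = {x ∈ ℝ₊^{Nn} | ∑ᵢ αᵢᵀ xᵢ ≤ b}`. -/
def couplingSet (G : AggregativeGame N n) (α : Profile N n) : Set (Profile N n) :=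
  {x | (∀ i l, 0 ≤ x i l) ∧ ∑ i, inner ℝ (α i) (x i) ≤ G.b}

/-- The aggregator `σ(x) = ∑ᵢ βᵢ xᵢ` with weights `β`. -/
noncomputable def aggregator (β : Weights N) (x : Profile N n) : Vec n :=
  ∑ i, β i • x i

/-- The `i`-th block of the pseudo-gradient for the weights `β`,
`Fᵢ(x; β) = ∇_{xᵢ} Jᵢ(·, σ) + βᵢ ∇_σ Jᵢ(xᵢ, ·)`, evaluated at `(xᵢ, σ(x))`. -/
noncomputable def pseudoGradient (G : AggregativeGame N n) (β : Weights N) (x : Profile N n)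
    (i : Fin N) : Vec n :=
  gradient (fun u => G.J i u (aggregator β x)) (x i) +
    β i • gradient (fun s => G.J i (x i) s) (aggregator β x)

/-- The constraints of the inverse problem for one data point `(α, x)` in the variables
`(β, γ, δ)`: `F(x; β)ᵀ x - γ b ≤ δ`, `γ ≤ 0`, and `Fᵢ(x; β) - γ αᵢ ≥ 0` coordinatewise. -/
def InverseConstraint (G : AggregativeGame N n) (α x : Profile N n)
    (β : Weights N) (γ δ : ℝ) : Prop :=
  (∑ i, inner ℝ (G.pseudoGradient β x i) (x i)) - γ * G.b ≤ δ ∧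
    γ ≤ 0 ∧
    ∀ i l, 0 ≤ G.pseudoGradient β x i l - γ * α i l

/-- The constraint set `𝒳(α, x)` of one data point: the pairs `(β, δ)` that satisfy the constraints
of the inverse problem for some multiplier `γ`. -/
def constraintSet (G : AggregativeGame N n) (α x : Profile N n) : Set (Weights N × ℝ) :=
  {p | ∃ γ : ℝ, G.InverseConstraint α x p.1 γ p.2}

/-- Feasibility of `(β, γ, δ)`, with `γ, δ ∈ ℝ^M`, in the data-driven inverse problem for the
`M` data points `(α[k], x*_{α[k]})`. -/
def IsFeasible (G : AggregativeGame N n) (xstar : Profile N n → Profile N n) {M : ℕ}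
    (α : Fin M → Profile N n) (β : Weights N) (γ δ : Fin M → ℝ) : Prop :=
  ∀ k, G.InverseConstraint (α k) (xstar (α k)) β (γ k) (δ k)

/-- `(β, δ)` is the outcome of the data-driven inverse problem
`min ‖δ‖_∞` over all feasible `(β, γ, δ)`: the number `δ` is the optimal value, `β` belongs to an
optimal solution, and its Euclidean norm is the least among all optimal solutions.
(The norm on `Fin M → ℝ` is the maximum norm.) -/
def IsLearned (G : AggregativeGame N n) (xstar : Profile N n → Profile N n) {M : ℕ}
    (α : Fin M → Profile N n) (β : Weights N) (δ : ℝ) : Prop :=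
  (∃ γ η : Fin M → ℝ, G.IsFeasible xstar α β γ η ∧ ‖η‖ = δ) ∧
    ∀ (β' : Weights N) (γ' η' : Fin M → ℝ), G.IsFeasible xstar α β' γ' η' →
      δ ≤ ‖η'‖ ∧ (‖η'‖ = δ → ‖β‖ ≤ ‖β'‖)

/-- The violation probability `𝕍(β, δ)`: the probability, when `α` has law `Q`, that
`α ∈ A` and `(β, δ) ∉ 𝒳(α, x*_α)`. -/
noncomputable def violation (G : AggregativeGame N n) (xstar : Profile N n → Profile N n)
    (Q : Measure (Profile N n)) (β : Weights N) (δ : ℝ) : ℝ :=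
  Q.real {α | α ∈ G.uncertainty ∧ (β, δ) ∉ G.constraintSet α (xstar α)}

end AggregativeGame

/-! This is the scenario bound for a random convex program in dimension `N + 1`. The multiplier γ of
each data point is projected out and one common bound δ replaces the η[k]; what remains is to
minimize δ, and then ‖β‖, over an intersection of M i.i.d. convex sets of pairs (β, δ).

A compression argument carries the bound. For a strictly convex objective in dimension d and a
sample in general position, exactly one index set I of size d is such that all other samples respect
the solution of I and have labels below those of its inactive constraints
(`ScenarioProgram.IsGeneric.existsUnique_compresses`, with Helly's theorem behind it). Let w be the
probability that a fresh sample is compatible in this sense with d given ones. Since the events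
indexed by I partition the samples of size k + d, C(k+d, d) E[w^k] = 1 for every k, so w has law
Beta(1, d). A violation above ε forces w < 1 - ε, and C(M, d) E[w^(M-d); w < 1 - ε] is the binomial
tail (`choose_mul_setIntegral_pow_eq`).

The actual program is reached by limits. General position is obtained by thickening the sets by
small random amounts; the lexicographic objective is the limit of δ² + τ‖β‖² as τ → 0. Violation of
a closed constraint is an open condition, so both limits pass through the Fatou lemma
`measure_le_of_eventually_mem`.

Two points are specific to the game. The constraint sets are closed because an interior point of the
coupling set bounds γ (`isClosed_constraintSet`). The moments need feasibility at every sample size,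
while solvability is assumed only for M; Helly's theorem in β-space bridges this
(`ae_nonempty_iInter`). -/

/-! ### Binomial tails and the moments of Beta(1, d) -/

/-- The lower tail of the binomial distribution, as a function of the failure probability `w`. -/
theorem hasDerivAt_sum_choose_mul_pow (M d : ℕ) (w : ℝ) :
    HasDerivAt (fun w : ℝ => ∑ l ∈ Finset.range d, (M.choose l : ℝ) * (1 - w) ^ l * w ^ (M - l))
      (d * M.choose d * (1 - w) ^ (d - 1) * w ^ (M - d)) w := by
  induction d with
  | zero => simpa using hasDerivAt_const w (0 : ℝ)
  | succ d ih =>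
    simp only [Finset.sum_range_succ]
    have h1 : HasDerivAt (fun w : ℝ => (M.choose d : ℝ) * (1 - w) ^ d * w ^ (M - d))
        ((M.choose d : ℝ) * (d * (1 - w) ^ (d - 1) * (-1)) * w ^ (M - d) +
          (M.choose d : ℝ) * (1 - w) ^ d * ((M - d : ℕ) * w ^ (M - d - 1))) w := by
      refine HasDerivAt.mul (HasDerivAt.const_mul _ ?_) ?_
      · simpa using ((hasDerivAt_id w).const_sub 1).fun_pow d
      · simpa using (hasDerivAt_id w).fun_pow (M - d)
    refine (ih.add h1).congr_deriv ?_
    -- The sum of derivatives telescopes: the negative part of the new term cancels the induction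
    -- hypothesis, and this identity rewrites the positive part.
    have h2 : ((d + 1 : ℕ) : ℝ) * M.choose (d + 1) = M.choose d * (M - d : ℕ) := by
      have := Nat.choose_succ_right_eq M d
      rw [mul_comm]; exact_mod_cast this
    rw [h2, Nat.add_sub_cancel, show M - (d + 1) = M - d - 1 by omega]
    ring

theorem integral_pow_mul_one_sub_pow_eq_sum (M d : ℕ) (hd : d ≤ M) (t : ℝ) :
    ∫ w in (0 : ℝ)..t, (d * M.choose d * (1 - w) ^ (d - 1) * w ^ (M - d) : ℝ) =
      (∑ l ∈ Finset.range d, (M.choose l : ℝ) * (1 - t) ^ l * t ^ (M - l)) := by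
  rw [intervalIntegral.integral_eq_sub_of_hasDerivAt
    (fun w _ => hasDerivAt_sum_choose_mul_pow M d w)
    (Continuous.intervalIntegrable (by fun_prop) _ _)]
  rw [sub_eq_self]
  refine Finset.sum_eq_zero fun l hl => ?_
  rw [zero_pow (by have := Finset.mem_range.1 hl; omega), mul_zero]

theorem sum_choose_one (M d : ℕ) (hd : 0 < d) :
    (∑ l ∈ Finset.range d, (M.choose l : ℝ) * (1 - 1) ^ l * 1 ^ (M - l)) = 1 := by
  rw [Finset.sum_eq_single_of_mem 0 (Finset.mem_range.2 hd)]
  · simp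
  · intro l _ hl; simp [hl]

/-- Two finite measures carried by `[0, 1]` that have the same moments agree. -/
theorem MeasureTheory.Measure.eq_of_moments_unit {μ ν : Measure ℝ} [IsFiniteMeasure μ]
    [IsFiniteMeasure ν] (hμ : ∀ᵐ w ∂μ, w ∈ Set.Icc (0 : ℝ) 1) (hν : ∀ᵐ w ∂ν, w ∈ Set.Icc (0 : ℝ) 1)
    (h : ∀ k : ℕ, ∫ w, w ^ k ∂μ = ∫ w, w ^ k ∂ν) : μ = ν := by
  have hint : ∀ (κ : Measure ℝ) [IsFiniteMeasure κ], (∀ᵐ w ∂κ, w ∈ Set.Icc (0 : ℝ) 1) →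
      ∀ f : ℝ → ℝ, Continuous f → Integrable f κ := by
    intro κ _ hκ f hf
    obtain ⟨C, hC⟩ := isCompact_Icc.exists_bound_of_continuousOn (s := Set.Icc (0 : ℝ) 1)
      hf.continuousOn
    exact Integrable.of_bound hf.aestronglyMeasurable C (hκ.mono fun w hw => hC w hw)
  have hpoly : ∀ p : Polynomial ℝ, ∫ w, p.eval w ∂μ = ∫ w, p.eval w ∂ν := by
    intro p
    simp only [Polynomial.eval_eq_sum_range]
    rw [integral_finsetSum _ fun i _ => hint μ hμ _ (by fun_prop),
      integral_finsetSum _ fun i _ => hint ν hν _ (by fun_prop)]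
    simp only [integral_const_mul, h]
  refine ext_of_forall_integral_eq_of_IsFiniteMeasure fun f => ?_
  have hf := f.continuous
  refine eq_of_forall_dist_le fun ε hε => ?_
  -- Weierstrass approximation to accuracy `ε / c` costs at most ε over both measures together; the
  -- summand 1 keeps `c` positive.
  set c := μ.real Set.univ + ν.real Set.univ + 1
  have hc : 0 < c := by positivity
  obtain ⟨p, hp⟩ := exists_polynomial_near_of_continuousOn 0 1 f hf.continuousOn (ε / c)
    (by positivity)
  have key : ∀ (κ : Measure ℝ) [IsFiniteMeasure κ], (∀ᵐ w ∂κ, w ∈ Set.Icc (0 : ℝ) 1) →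
      |∫ w, p.eval w ∂κ - ∫ w, f w ∂κ| ≤ ε / c * κ.real Set.univ := by
    intro κ _ hκ
    rw [← integral_sub (hint κ hκ _ p.continuous) (hint κ hκ _ hf), ← Real.norm_eq_abs]
    refine norm_integral_le_of_norm_le_const (hκ.mono fun w hw => ?_)
    exact (hp w hw).le
  have h1 := abs_le.1 (key μ hμ)
  have h2 := abs_le.1 (key ν hν)
  have h3 := hpoly p
  have h4 : ε / c * μ.real Set.univ + ε / c * ν.real Set.univ ≤ ε := by
    rw [← mul_add]
    calc ε / c * (μ.real Set.univ + ν.real Set.univ) ≤ ε / c * c := by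
          gcongr; simp only [c]; linarith
      _ = ε := by field_simp
  rw [Real.dist_eq, abs_le]
  constructor <;> linarith [h1.1, h1.2, h2.1, h2.2]

/-- A law on `[0, 1]` with the moments of the Beta distribution `Beta(1, d)` has the binomial tail
as its truncated moments. -/
theorem choose_mul_setIntegral_pow_eq {F : Measure ℝ} [IsProbabilityMeasure F]
    (hF : ∀ᵐ w ∂F, w ∈ Set.Icc (0 : ℝ) 1) {d : ℕ} (hd : 0 < d)
    (hmom : ∀ k : ℕ, ((k + d).choose d : ℝ) * ∫ w, w ^ k ∂F = 1)
    {M : ℕ} (hM : d ≤ M) {t : ℝ} (ht : t ∈ Set.Icc (0 : ℝ) 1) :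
    (M.choose d : ℝ) * ∫ w in Set.Iio t, w ^ (M - d) ∂F =
      ∑ l ∈ Finset.range d, (M.choose l : ℝ) * (1 - t) ^ l * t ^ (M - l) := by
  -- The Beta(1, d) law, given by its density on (0, 1].
  set B : Measure ℝ := (volume.restrict (Set.Ioc (0 : ℝ) 1)).withDensity
    fun w => ENNReal.ofReal (d * (1 - w) ^ (d - 1)) with hB
  have hmeas : Measurable fun w : ℝ => ENNReal.ofReal (d * (1 - w) ^ (d - 1)) := by fun_prop
  have hfin : ∫⁻ w in Set.Ioc (0 : ℝ) 1, ENNReal.ofReal (d * (1 - w) ^ (d - 1)) ≠ ⊤ := by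
    have : Continuous fun w : ℝ => (d * (1 - w) ^ (d - 1) : ℝ) := by fun_prop
    exact (this.integrableOn_Ioc (a := 0) (b := 1)).lintegral_lt_top.ne
  have : IsFiniteMeasure B := isFiniteMeasure_withDensity hfin
  have hBint : ∀ (s : Set ℝ) (_ : MeasurableSet s) (k : ℕ), ∫ w in s, w ^ k ∂B =
      ∫ w in s ∩ Set.Ioc (0 : ℝ) 1, (d * (1 - w) ^ (d - 1)) * w ^ k := by
    intro s hs k
    rw [hB, restrict_withDensity hs, Measure.restrict_restrict hs,
      integral_withDensity_eq_integral_toReal_smul hmeas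
        (Filter.Eventually.of_forall fun _ => ENNReal.ofReal_lt_top)]
    refine setIntegral_congr_fun (hs.inter measurableSet_Ioc) fun w hw => ?_
    have : 0 ≤ 1 - w := by linarith [hw.2.2]
    simp only [smul_eq_mul]
    rw [ENNReal.toReal_ofReal (by positivity)]
  have hBsupp : ∀ᵐ w ∂B, w ∈ Set.Icc (0 : ℝ) 1 := by
    refine (withDensity_absolutelyContinuous _ _).ae_le ?_
    exact (ae_restrict_mem measurableSet_Ioc).mono fun w hw => ⟨hw.1.le, hw.2⟩
  have hval : ∀ (m : ℕ) (_ : d ≤ m) (t : ℝ) (_ : t ∈ Set.Icc (0 : ℝ) 1), (m.choose d : ℝ) *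
      ∫ w in Set.Ioc 0 t, ((d * (1 - w) ^ (d - 1)) * w ^ (m - d) : ℝ) =
      ∑ l ∈ Finset.range d, (m.choose l : ℝ) * (1 - t) ^ l * t ^ (m - l) := by
    intro m hm t ht
    rw [← integral_pow_mul_one_sub_pow_eq_sum m d hm, ← intervalIntegral.integral_of_le ht.1,
      ← intervalIntegral.integral_const_mul]
    congr 1; ext w; ring
  -- At t = 1 the binomial tail equals 1, so `hval` with m = k + d yields exactly the moments
  -- prescribed by `hmom`.
  have hFB : F = B := by
    refine Measure.eq_of_moments_unit hF hBsupp fun k => ?_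
    have hc : ((k + d).choose d : ℝ) ≠ 0 := by
      exact_mod_cast (Nat.choose_pos (by omega)).ne'
    refine mul_left_cancel₀ hc ?_
    have h1 := hval (k + d) (by omega) 1 (by simp)
    rw [sum_choose_one _ _ hd, Nat.add_sub_cancel] at h1
    rw [hmom, ← h1, ← setIntegral_univ (μ := B), hBint _ MeasurableSet.univ, Set.univ_inter]
  rw [hFB, hBint _ measurableSet_Iio, ← hval M hM t ht]
  congr 1
  refine setIntegral_congr_set ?_
  have : Set.Iio t ∩ Set.Ioc 0 1 = Set.Ioo 0 t := by
    ext w; simp only [Set.mem_inter_iff, Set.mem_Iio, Set.mem_Ioc, Set.mem_Ioo]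
    constructor
    · rintro ⟨a, b, c⟩; exact ⟨b, a⟩
    · rintro ⟨a, b⟩; exact ⟨b, a, b.le.trans ht.2⟩
  rw [this]
  exact Ioo_ae_eq_Ioc

/-! ### Measurability of feasibility and of minimizers -/

section Measurability

variable {Z E : Type*} [MeasurableSpace Z] [PseudoMetricSpace E] {h : Z → E → ℝ}

/-- By compactness the infimum over `K` is attained, so solvability means that for every n some
point of a countable dense subset has value below 1/(n+1). -/
theorem IsCompact.measurableSet_exists_mem_le_zero {K : Set E} (hK : IsCompact K)
    (hm : ∀ x, Measurable fun z => h z x) (hc : ∀ z, Continuous (h z)) :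
    MeasurableSet {z | ∃ x ∈ K, h z x ≤ 0} := by
  rcases K.eq_empty_or_nonempty with rfl | hne
  · simp
  have : TopologicalSpace.SeparableSpace K := hK.isSeparable.separableSpace
  obtain ⟨s, hs, hd⟩ := TopologicalSpace.exists_countable_dense K
  have heq : {z | ∃ x ∈ K, h z x ≤ 0} =
      ⋂ n : ℕ, ⋃ q ∈ s, {z | h z q < 1 / ((n : ℝ) + 1)} := by
    ext z
    simp only [Set.mem_ofPred_eq, Set.mem_iInter, Set.mem_iUnion]
    constructor
    · rintro ⟨x, hx, hle⟩ n
      have ho : IsOpen {q : K | h z q < 1 / ((n : ℝ) + 1)} :=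
        isOpen_lt ((hc z).comp continuous_subtype_val) continuous_const
      obtain ⟨q, hq, hqs⟩ := hd.inter_open_nonempty _ ho ⟨⟨x, hx⟩, hle.trans_lt (by positivity)⟩
      exact ⟨q, hqs, hq⟩
    · intro H
      obtain ⟨x, hx, hmin⟩ := hK.exists_isMinOn hne (hc z).continuousOn
      refine ⟨x, hx, le_of_forall_pos_le_add fun ε hε => ?_⟩
      obtain ⟨n, hn⟩ := exists_nat_one_div_lt hε
      obtain ⟨q, -, hq⟩ := H n
      have := hmin q.2
      simp only [Set.mem_ofPred_eq] at this
      linarith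
  rw [heq]
  exact MeasurableSet.iInter fun n => MeasurableSet.biUnion hs fun q _ =>
    measurableSet_lt (hm q) measurable_const

/-- Solvability of a Carathéodory inequality is a measurable condition. -/
theorem IsClosed.measurableSet_exists_mem_le_zero [ProperSpace E] {F : Set E} (hF : IsClosed F)
    (hm : ∀ x, Measurable fun z => h z x) (hc : ∀ z, Continuous (h z)) :
    MeasurableSet {z | ∃ x ∈ F, h z x ≤ 0} := by
  rcases F.eq_empty_or_nonempty with rfl | ⟨x₀, -⟩
  · simp
  have heq : {z | ∃ x ∈ F, h z x ≤ 0} =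
      ⋃ n : ℕ, {z | ∃ x ∈ F ∩ Metric.closedBall x₀ n, h z x ≤ 0} := by
    ext z
    simp only [Set.mem_ofPred_eq, Set.mem_iUnion]
    constructor
    · rintro ⟨x, hx, hle⟩
      obtain ⟨n, hn⟩ := exists_nat_ge (dist x x₀)
      exact ⟨n, x, ⟨hx, hn⟩, hle⟩
    · rintro ⟨n, x, hx, hle⟩
      exact ⟨x, hx.1, hle⟩
  rw [heq]
  exact MeasurableSet.iUnion fun n =>
    ((isCompact_closedBall x₀ n).inter_left hF).measurableSet_exists_mem_le_zero hm hc

/-- Unique minimizers of a continuous function over a Carathéodory constraint depend measurably on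
the parameter. -/
theorem measurable_of_unique_minimizer [ProperSpace E] [MeasurableSpace E] [BorelSpace E]
    (hm : ∀ x, Measurable fun z => h z x) (hc : ∀ z, Continuous (h z))
    {φ : E → ℝ} (hφ : Continuous φ) {s : Z → E} (x₀ : E)
    (hs : ∀ z, (∃ x, h z x ≤ 0) → h z (s z) ≤ 0)
    (hlt : ∀ z x, h z x ≤ 0 → x ≠ s z → φ (s z) < φ x)
    (hs₀ : ∀ z, (¬ ∃ x, h z x ≤ 0) → s z = x₀) : Measurable s := by
  have hfeas : MeasurableSet {z | ∃ x, h z x ≤ 0} := by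
    simpa using isClosed_univ.measurableSet_exists_mem_le_zero hm hc
  have hval : Measurable fun z => φ (s z) := by
    refine measurable_of_Iic fun c => ?_
    -- The optimal value is at most c iff adding the constraint φ ≤ c leaves the problem solvable.
    have heq : (fun z => φ (s z)) ⁻¹' Set.Iic c =
        {z | ∃ x ∈ Set.univ, max (h z x) (φ x - c) ≤ 0} ∪
          ({z | ∃ x, h z x ≤ 0}ᶜ ∩ {_z | φ x₀ ≤ c}) := by
      ext z
      simp only [Set.mem_preimage, Set.mem_Iic, Set.mem_union, Set.mem_ofPred_eq, Set.mem_univ,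
        true_and, max_le_iff, sub_nonpos, Set.mem_inter_iff, Set.mem_compl_iff]
      by_cases hz : ∃ x, h z x ≤ 0
      · simp only [hz, not_true_eq_false, false_and, or_false]
        constructor
        · intro H; exact ⟨s z, hs z hz, H⟩
        · rintro ⟨x, hx, hxc⟩
          by_cases hxs : x = s z
          · rwa [← hxs]
          · exact (hlt z x hx hxs).le.trans hxc
      · rw [hs₀ z hz]
        push Not at hz
        constructor
        · intro H; exact Or.inr ⟨by simpa using hz, H⟩
        · rintro (⟨x, hx, -⟩ | H)
          · exact absurd hx (hz x).not_ge
          · exact H.2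
    rw [heq]
    exact (isClosed_univ.measurableSet_exists_mem_le_zero (fun x => (hm x).max measurable_const)
      fun z => (hc z).max (hφ.sub continuous_const)).union
      (hfeas.compl.inter (MeasurableSet.const _))
  refine measurable_of_isClosed fun F hF => ?_
  -- By uniqueness, the minimizer lies in `F` iff `F` contains a feasible point at least as good.
  -- The optimal value is now known to be measurable, so this is again a Carathéodory inequality.
  have heq : s ⁻¹' F = {z | ∃ x ∈ F, max (h z x) (φ x - φ (s z)) ≤ 0} ∪
      ({z | ∃ x, h z x ≤ 0}ᶜ ∩ {_z | x₀ ∈ F}) := by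
    ext z
    simp only [Set.mem_preimage, Set.mem_union, Set.mem_ofPred_eq, max_le_iff, sub_nonpos,
      Set.mem_inter_iff, Set.mem_compl_iff]
    by_cases hz : ∃ x, h z x ≤ 0
    · simp only [hz, not_true_eq_false, false_and, or_false]
      constructor
      · intro H; exact ⟨s z, H, hs z hz, le_rfl⟩
      · rintro ⟨x, hx, hx0, hxc⟩
        by_cases hxs : x = s z
        · rwa [← hxs]
        · exact absurd hxc (hlt z x hx0 hxs).not_ge
    · rw [hs₀ z hz]
      push Not at hz
      constructor
      · intro H; exact Or.inr ⟨by simpa using hz, H⟩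
      · rintro (⟨x, -, hx, -⟩ | H)
        · exact absurd hx (hz x).not_ge
        · exact H.2
  rw [heq]
  exact (hF.measurableSet_exists_mem_le_zero
    (fun x => (hm x).max (measurable_const.sub hval))
    fun z => (hc z).max (hφ.sub continuous_const)).union
    (hfeas.compl.inter (MeasurableSet.const _))

end Measurability

/-! ### Fatou's lemma for sets and subsamples of i.i.d. samples -/

/-- A form of Fatou's lemma for sets, without measurability. -/
theorem MeasureTheory.measure_le_of_eventually_mem {Ω : Type*} [MeasurableSpace Ω]
    {μ : Measure Ω} {B : Set Ω} {C : ℕ → Set Ω} {c : ENNReal}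
    (h : ∀ᵐ ω ∂μ, ω ∈ B → ∀ᶠ n in Filter.atTop, ω ∈ C n)
    (hc : ∃ᶠ n in Filter.atTop, μ (C n) ≤ c) : μ B ≤ c := by
  have hsub : B ≤ᵐ[μ] ⋃ n : ℕ, ⋂ k ≥ n, C k := by
    filter_upwards [h] with ω hω hB
    obtain ⟨n, hn⟩ := Filter.eventually_atTop.1 (hω hB)
    exact Set.mem_iUnion.2 ⟨n, Set.mem_iInter₂.2 hn⟩
  have hmono : Monotone fun n : ℕ => ⋂ k ≥ n, C k := by
    intro a b hab
    exact Set.biInter_subset_biInter_left fun k (hk : b ≤ k) => hab.trans hk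
  refine (measure_mono_ae hsub).trans ?_
  rw [hmono.measure_iUnion]
  refine iSup_le fun n => ?_
  obtain ⟨k, hk, hkc⟩ := Filter.frequently_atTop.1 hc n
  exact (measure_mono (Set.biInter_subset_of_mem hk)).trans hkc

/-- Selecting coordinates of an i.i.d. sample yields an i.i.d. sample. -/
theorem MeasureTheory.measurePreserving_comp_injective {Ω ι κ : Type*} [MeasurableSpace Ω]
    [Fintype ι] [Fintype κ] (P : Measure Ω) [IsProbabilityMeasure P] {e : ι → κ}
    (he : Function.Injective e) :
    MeasurePreserving (fun (S : κ → Ω) (i : ι) => S (e i)) (Measure.pi fun _ => P)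
      (Measure.pi fun _ => P) := by
  have hm : Measurable fun (S : κ → Ω) (i : ι) => S (e i) := by fun_prop
  refine ⟨hm, (Measure.pi_eq fun s hs => ?_).symm⟩
  rw [Measure.map_apply hm (MeasurableSet.univ_pi hs)]
  have heq : (fun (S : κ → Ω) (i : ι) => S (e i)) ⁻¹' Set.univ.pi s =
      Set.univ.pi (Function.extend e s fun _ => Set.univ) := by
    ext S
    simp only [Set.mem_preimage, Set.mem_pi, Set.mem_univ, true_implies]
    constructor
    · intro H j
      by_cases hj : ∃ i, e i = j
      · obtain ⟨i, rfl⟩ := hj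
        rw [he.extend_apply]; exact H i
      · rw [Function.extend_apply' _ _ _ hj]; trivial
    · intro H i
      have := H (e i)
      rwa [he.extend_apply] at this
  rw [heq, Measure.pi_pi]
  symm
  refine Finset.prod_of_injOn e he.injOn (fun _ _ => Finset.mem_coe.2 (Finset.mem_univ _)) ?_ ?_
  · intro j _ hj
    rw [Function.extend_apply' _ _ _ (by simpa using hj)]
    exact measure_univ
  · intro i _
    rw [he.extend_apply]

/-! ### Convex programs and their compression sets -/

section Argmin

variable {E : Type*} [NormedAddCommGroup E]

open Classical in
/-- A minimizer of `φ` over `C`, and `0` if there is none. -/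
noncomputable def argmin (φ : E → ℝ) (C : Set E) : E :=
  -- The default must be a fixed point: `measurable_of_unique_minimizer` requires a constant value
  -- at infeasible parameters.
  if h : ∃ x ∈ C, IsMinOn φ C x then h.choose else 0

theorem argmin_empty (φ : E → ℝ) : argmin φ ∅ = 0 := by
  simp [argmin]

variable {φ : E → ℝ} {C : Set E}

theorem argmin_spec (hφ : Continuous φ) (hco : Filter.Tendsto φ (Filter.cocompact E) Filter.atTop)
    (hC : IsClosed C) (hne : C.Nonempty) : argmin φ C ∈ C ∧ IsMinOn φ C (argmin φ C) := by
  have h : ∃ x ∈ C, IsMinOn φ C x := by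
    obtain ⟨x₀, hx₀⟩ := hne
    refine hφ.continuousOn.exists_isMinOn' hC hx₀ ?_
    exact (hco.eventually_ge_atTop _).filter_mono inf_le_left
  rw [argmin, dif_pos h]
  exact h.choose_spec

theorem argmin_mem (hφ : Continuous φ) (hco : Filter.Tendsto φ (Filter.cocompact E) Filter.atTop)
    (hC : IsClosed C) (hne : C.Nonempty) : argmin φ C ∈ C :=
  (argmin_spec hφ hco hC hne).1

theorem argmin_lt [NormedSpace ℝ E] (hφ : Continuous φ) (hco : Filter.Tendsto φ (Filter.cocompact E) Filter.atTop)
    (hsc : StrictConvexOn ℝ Set.univ φ) (hC : IsClosed C) (hcv : Convex ℝ C) {x : E} (hx : x ∈ C)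
    (hne : x ≠ argmin φ C) : φ (argmin φ C) < φ x := by
  obtain ⟨hmem, hmin⟩ := argmin_spec hφ hco hC ⟨x, hx⟩
  refine lt_of_le_of_ne (hmin hx) fun heq => hne ?_
  exact (hsc.subset (Set.subset_univ _) hcv).eq_of_isMinOn
    (fun y hy => heq ▸ hmin hy) hmin hx hmem

end Argmin

/-- A family of convex constraints `g ω x ≤ 0`, a strictly convex coercive objective `φ`, and labels
in `[0, 1]` that are used to break ties between constraints. -/
structure ScenarioProgram (Ω E : Type*) [NormedAddCommGroup E] [NormedSpace ℝ E] where
  /-- the constraint functions -/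
  g : Ω → E → ℝ
  /-- the objective -/
  φ : E → ℝ
  /-- the labels of the constraints -/
  label : Ω → ℝ
  continuous_g : ∀ ω, Continuous (g ω)
  convex_g : ∀ ω, Convex ℝ {x | g ω x ≤ 0}
  continuous_φ : Continuous φ
  coercive_φ : Filter.Tendsto φ (Filter.cocompact E) Filter.atTop
  strictConvex_φ : StrictConvexOn ℝ Set.univ φ
  label_mem : ∀ ω, label ω ∈ Set.Icc (0 : ℝ) 1

/-- A finite injectively scored type has a subset of the `d` highest scores. -/
theorem Finset.exists_card_eq_forall_lt {ι : Type*} [Fintype ι] [DecidableEq ι] {key : ι → ℝ}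
    (hkey : Function.Injective key) {d : ℕ} (hd : d ≤ Fintype.card ι) :
    ∃ I : Finset ι, I.card = d ∧ ∀ i ∈ I, ∀ j ∉ I, key j < key i := by
  have hne : (Finset.powersetCard d (Finset.univ : Finset ι)).Nonempty :=
    Finset.powersetCard_nonempty.2 (by simpa using hd)
  -- A subset of maximal total score works: otherwise exchanging `i` for `j` would increase the
  -- total.
  obtain ⟨I, hI, hmax⟩ := Finset.exists_max_image _ (fun I => ∑ i ∈ I, key i) hne
  rw [Finset.mem_powersetCard] at hI
  refine ⟨I, hI.2, fun i hi j hj => ?_⟩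
  by_contra hlt
  have hij : i ≠ j := fun h => hj (h ▸ hi)
  have hlt' : key i < key j := lt_of_le_of_ne (not_lt.1 hlt) fun h => hij (hkey h)
  have hj' : j ∉ I.erase i := fun h => hj (Finset.mem_of_mem_erase h)
  have := hmax (insert j (I.erase i)) (Finset.mem_powersetCard.2 ⟨Finset.subset_univ _, by
    rw [Finset.card_insert_of_notMem hj', Finset.card_erase_of_mem hi, hI.2]
    have := Finset.card_pos.2 ⟨i, hi⟩
    omega⟩)
  rw [Finset.sum_insert hj'] at this
  have h2 := Finset.add_sum_erase I key hi
  linarith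

namespace ScenarioProgram

variable {Ω E : Type*} [NormedAddCommGroup E] [NormedSpace ℝ E]
  (p : ScenarioProgram Ω E) {ι κ : Type*}

/-- The feasible set of a sample. -/
def feasible (S : ι → Ω) : Set E := {x | ∀ i, p.g (S i) x ≤ 0}

/-- The optimal solution for a sample. -/
noncomputable def sol (S : ι → Ω) : E := argmin p.φ (p.feasible S)

theorem feasible_eq_iInter (S : ι → Ω) : p.feasible S = ⋂ i, {x | p.g (S i) x ≤ 0} := by
  ext x; simp [feasible]

theorem isClosed_feasible (S : ι → Ω) : IsClosed (p.feasible S) := by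
  rw [feasible_eq_iInter]
  exact isClosed_iInter fun i => isClosed_le (p.continuous_g _) continuous_const

theorem convex_feasible (S : ι → Ω) : Convex ℝ (p.feasible S) := by
  rw [feasible_eq_iInter]
  exact convex_iInter fun i => p.convex_g _

theorem sol_mem {S : ι → Ω} (h : (p.feasible S).Nonempty) : p.sol S ∈ p.feasible S :=
  argmin_mem p.continuous_φ p.coercive_φ (p.isClosed_feasible S) h

theorem sol_lt {S : ι → Ω} {x : E} (hx : x ∈ p.feasible S) (hne : x ≠ p.sol S) :
    p.φ (p.sol S) < p.φ x :=
  argmin_lt p.continuous_φ p.coercive_φ p.strictConvex_φ (p.isClosed_feasible S)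
    (p.convex_feasible S) hx hne

theorem sol_congr_range {S : ι → Ω} {T : κ → Ω} (h : Set.range S = Set.range T) :
    p.sol S = p.sol T := by
  have : p.feasible S = p.feasible T := by
    ext x
    change (∀ i, p.g (S i) x ≤ 0) ↔ ∀ i, p.g (T i) x ≤ 0
    rw [← Set.forall_mem_range (f := S) (p := fun ω => p.g ω x ≤ 0),
      ← Set.forall_mem_range (f := T) (p := fun ω => p.g ω x ≤ 0), h]
  rw [sol, sol, this]

/-- The restriction of a sample to a set of indices. -/
abbrev sub (S : ι → Ω) (I : Finset ι) : I → Ω := fun i => S i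

variable {S : ι → Ω}

theorem feasible_subset_sub (S : ι → Ω) (I : Finset ι) :
    p.feasible S ⊆ p.feasible (sub S I) := fun _ hx i => hx i

/-- A relaxed optimum that is feasible for the full problem is also optimal there, and optima are
unique. -/
theorem sol_sub_eq_of_mem {I : Finset ι} (h : p.sol (sub S I) ∈ p.feasible S) :
    p.sol (sub S I) = p.sol S := by
  by_contra hne
  have h1 := p.sol_lt h hne
  have h2 := p.sol_lt (p.feasible_subset_sub S I (p.sol_mem ⟨_, h⟩)) (Ne.symm hne)
  exact lt_asymm h1 h2

/-- Only the active constraints matter for the optimal solution. -/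
theorem sol_sub_eq_of_active_subset [Finite ι] (hS : (p.feasible S).Nonempty) {I : Finset ι}
    (hI : ∀ i ∉ I, p.g (S i) (p.sol S) < 0) : p.sol (sub S I) = p.sol S := by
  by_contra hne
  have hmem := p.feasible_subset_sub S I (p.sol_mem hS)
  have hlt := p.sol_lt hmem (Ne.symm hne)
  have hy := p.sol_mem ⟨_, hmem⟩
  set x := p.sol S
  set y := p.sol (sub S I)
  have hcont : Continuous fun t : ℝ => (1 - t) • x + t • y := by fun_prop
  -- Move from x slightly towards the better point y. Constraints outside `I` have slack at x and
  -- survive by continuity; those in `I` hold at both ends and survive by convexity. Thus x could be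
  -- improved.
  have hev : ∀ᶠ t : ℝ in nhdsWithin 0 (Set.Ioi 0), ∀ i, i ∉ I →
      p.g (S i) ((1 - t) • x + t • y) < 0 := by
    refine Filter.eventually_all.2 fun i => ?_
    by_cases hi : i ∈ I
    · simp [hi]
    refine Filter.Eventually.filter_mono nhdsWithin_le_nhds ?_
    have : Filter.Tendsto (fun t : ℝ => p.g (S i) ((1 - t) • x + t • y)) (nhds 0)
        (nhds (p.g (S i) x)) := by
      have := ((p.continuous_g (S i)).comp hcont).tendsto 0
      simpa [Function.comp_def] using this
    exact (this.eventually_lt_const (hI i hi)).mono fun t ht _ => ht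
  have hev1 : ∀ᶠ t : ℝ in nhdsWithin 0 (Set.Ioi 0), t ∈ Set.Ioo (0 : ℝ) 1 :=
    Ioo_mem_nhdsGT one_pos
  obtain ⟨t, ht, ht0, ht1⟩ := (hev.and hev1).exists
  have hfe : (1 - t) • x + t • y ∈ p.feasible S := by
    intro i
    by_cases hi : i ∈ I
    · exact p.convex_g (S i) (hmem ⟨i, hi⟩) (hy ⟨i, hi⟩) (by linarith) ht0.le (by ring)
    · exact (ht i hi).le
  have hφ : p.φ ((1 - t) • x + t • y) < p.φ x := by
    have := p.strictConvex_φ.2 (Set.mem_univ x) (Set.mem_univ y) (Ne.symm hne)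
      (by linarith : 0 < 1 - t) ht0 (by ring)
    simp only [smul_eq_mul] at this
    nlinarith
  by_cases hx : (1 - t) • x + t • y = x
  · rw [hx] at hφ; exact lt_irrefl _ hφ
  · exact lt_asymm hφ (p.sol_lt hfe hx)

/-- The optimal solution is determined by at most `dim E` constraints. -/
theorem exists_sol_sub_eq [FiniteDimensional ℝ E] [Fintype ι] (hS : (p.feasible S).Nonempty) :
    ∃ I : Finset ι, I.card ≤ Module.finrank ℝ E ∧ p.sol (sub S I) = p.sol S := by
  classical
  by_contra! H
  -- Helly's theorem is applied to the constraints together with the set of strictly better points.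
  -- Any `dim E + 1` of these sets meet: if the better points are among them, at most `dim E`
  -- constraints remain, whose solution is strictly better by `H`; otherwise the optimum itself is
  -- common. A point in all of them contradicts optimality.
  let F : Option ι → Set E := fun o =>
    o.elim {x | p.φ x < p.φ (p.sol S)} fun i => {x | p.g (S i) x ≤ 0}
  have hconv : ∀ o ∈ (Finset.univ : Finset (Option ι)), Convex ℝ (F o) := by
    rintro (_ | i) -
    · simpa [F] using p.strictConvex_φ.convexOn.convex_lt (p.φ (p.sol S))
    · exact p.convex_g _
  obtain ⟨x, hx⟩ := Convex.helly_theorem' (𝕜 := ℝ) hconv (by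
    intro I _ hI
    by_cases hnone : none ∈ I
    · have hcard : I.eraseNone.card ≤ Module.finrank ℝ E := by
        have h1 := Finset.card_eraseNone_of_mem hnone
        omega
      have hmem := p.feasible_subset_sub S I.eraseNone (p.sol_mem hS)
      refine ⟨p.sol (sub S I.eraseNone), Set.mem_iInter₂.2 ?_⟩
      rintro (_ | i) hi
      · exact p.sol_lt hmem (Ne.symm (H _ hcard))
      · exact p.sol_mem ⟨_, hmem⟩ ⟨i, Finset.mem_eraseNone.2 hi⟩
    · refine ⟨p.sol S, Set.mem_iInter₂.2 ?_⟩
      rintro (_ | i) hi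
      · exact absurd hi hnone
      · exact p.sol_mem hS i)
  have hx' := Set.mem_iInter₂.1 hx
  have h1 : p.φ x < p.φ (p.sol S) := hx' none (Finset.mem_univ _)
  have h2 : x ∈ p.feasible S := fun i => hx' (some i) (Finset.mem_univ _)
  by_cases hxs : x = p.sol S
  · rw [hxs] at h1; exact lt_irrefl _ h1
  · exact lt_asymm h1 (p.sol_lt h2 hxs)

/-- The samples that leave the compression of `y` unchanged: they respect the constraint, and they
rank below all inactive constraints of `y`. -/
def compat (y : ι → Ω) : Set Ω :=
  {ω | p.g ω (p.sol y) ≤ 0 ∧ ∀ i, p.g (y i) (p.sol y) < 0 → p.label ω < p.label (y i)}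

/-- `I` is a compression set of the sample `S`. -/
def Compresses (S : ι → Ω) (I : Finset ι) : Prop := ∀ j ∉ I, S j ∈ p.compat (sub S I)

/-- A sample in general position with respect to index sets of size `d`. -/
structure IsGeneric (S : ι → Ω) (d : ℕ) : Prop where
  nonempty : (p.feasible S).Nonempty
  ne_zero : ∀ I : Finset ι, I.card = d → ∀ j ∉ I, p.g (S j) (p.sol (sub S I)) ≠ 0
  label_ne : ∀ i j, i ≠ j → p.label (S i) ≠ p.label (S j)

theorem Compresses.sol_eq {I : Finset ι} (h : p.Compresses S I) (hS : (p.feasible S).Nonempty) :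
    p.sol (sub S I) = p.sol S := by
  refine p.sol_sub_eq_of_mem fun i => ?_
  by_cases hi : i ∈ I
  · exact p.sol_mem (hS.mono (p.feasible_subset_sub S I)) ⟨i, hi⟩
  · exact (h i hi).1

/-- A sample in general position has exactly one compression set of the size of the dimension. -/
theorem IsGeneric.existsUnique_compresses [FiniteDimensional ℝ E] [Fintype ι]
    (h : p.IsGeneric S (Module.finrank ℝ E)) (hd : Module.finrank ℝ E ≤ Fintype.card ι) :
    ∃! I : Finset ι, I.card = Module.finrank ℝ E ∧ p.Compresses S I := by
  classical
  set d := Module.finrank ℝ E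
  set x := p.sol S with hx
  have hfeas : ∀ i, p.g (S i) x ≤ 0 := p.sol_mem h.nonempty
  -- Labels lie in [0, 1], so the bonus 2 ranks every active constraint above every inactive one.
  -- The compression set will be the set of the d highest keys.
  set key : ι → ℝ := fun i => p.label (S i) + if p.g (S i) x < 0 then 0 else 2 with hkey
  have hinj : Function.Injective key := by
    intro i j hij
    by_contra hne
    have h1 := p.label_mem (S i)
    have h2 := p.label_mem (S j)
    have h3 := h.label_ne i j hne
    simp only [hkey] at hij
    split_ifs at hij
    · exact h3 (by linarith)
    · linarith [h1.1, h1.2, h2.1, h2.2]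
    · linarith [h1.1, h1.2, h2.1, h2.2]
    · exact h3 (by linarith)
  have htop : ∀ I : Finset ι, I.card = d → p.Compresses S I →
      ∀ i ∈ I, ∀ j ∉ I, key j < key i := by
    intro I hI hc i hi j hj
    have hsol := hc.sol_eq p h.nonempty
    have hj0 : p.g (S j) x < 0 :=
      lt_of_le_of_ne (hfeas j) (by rw [hx, ← hsol]; exact h.ne_zero I hI j hj)
    have h1 := p.label_mem (S i)
    have h2 := p.label_mem (S j)
    simp only [hkey, hj0, if_true]
    split_ifs with hi0
    · have := (hc j hj).2 ⟨i, hi⟩ (by rw [hsol]; exact hi0)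
      simpa using this
    · linarith [h1.1, h1.2, h2.1, h2.2]
  obtain ⟨I, hI, hIkey⟩ := Finset.exists_card_eq_forall_lt hinj hd
  refine ⟨I, ⟨hI, ?_⟩, ?_⟩
  · obtain ⟨I₁, hI₁, hsol₁⟩ := p.exists_sol_sub_eq h.nonempty
    obtain ⟨I₂, hI₁₂, hI₂⟩ := Finset.exists_superset_card_eq hI₁ hd
    -- As I₁ ⊆ I₂, the value for I₂ lies between those for I₁ and for all constraints, which
    -- coincide.
    have hsol₂ : p.sol (sub S I₂) = x := by
      refine p.sol_sub_eq_of_mem fun i => ?_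
      have hmem := p.feasible_subset_sub S I₂ (p.sol_mem h.nonempty)
      by_cases hs : p.sol (sub S I₂) = p.sol S
      · rw [hs]; exact hfeas i
      · have h1 := p.sol_lt hmem (Ne.symm hs)
        have h2 : p.sol (sub S I₂) ∈ p.feasible (sub S I₁) :=
          fun i => p.sol_mem ⟨_, hmem⟩ ⟨i, hI₁₂ i.2⟩
        exact absurd (p.sol_lt h2 (by rw [hsol₁]; exact hs)) (by rw [hsol₁]; exact h1.not_gt)
    have hact : ∀ i ∉ I₂, p.g (S i) x < 0 := fun i hi =>
      lt_of_le_of_ne (hfeas i) (by rw [← hsol₂]; exact h.ne_zero I₂ hI₂ i hi)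
    -- All active constraints lie in I₂. An active j outside `I` would make everything in `I` active
    -- as well, placing d + 1 indices in I₂.
    have hactI : ∀ j ∉ I, p.g (S j) x < 0 := by
      intro j hj
      by_contra hj0
      have hsub : insert j I ⊆ I₂ := by
        intro i hi
        by_contra hi2
        have hi0 := hact i hi2
        rcases Finset.mem_insert.1 hi with rfl | hi
        · exact hj0 hi0
        · have := hIkey i hi j hj
          simp only [hkey, hi0, hj0, if_true, if_false] at this
          linarith [(p.label_mem (S i)).2, (p.label_mem (S j)).1]
      have := Finset.card_le_card hsub
      rw [Finset.card_insert_of_notMem hj] at this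
      omega
    have hsol := p.sol_sub_eq_of_active_subset h.nonempty hactI
    intro j hj
    refine ⟨by rw [hsol]; exact hfeas j, fun i hi => ?_⟩
    rw [hsol] at hi
    have := hIkey i i.2 j hj
    simp only [hkey] at this
    rw [if_pos (hactI j hj), if_pos hi] at this
    simpa using this
  · rintro J ⟨hJ, hc⟩
    have hJkey := htop J hJ hc
    refine Finset.eq_of_subset_of_card_le (fun i hi => ?_) (by rw [hI, hJ])
    by_contra hiI
    have : ¬ I ⊆ J := fun hIJ => by
      have := Finset.eq_of_subset_of_card_le hIJ (by rw [hI, hJ])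
      exact hiI (this ▸ hi)
    obtain ⟨j, hjI, hjJ⟩ := Finset.not_subset.1 this
    exact lt_asymm (hJkey i hi j hjJ) (hIkey j hjI i hiI)

end ScenarioProgram

/-! ### Compression probabilities and the bound in general position -/

/-- Two disjoint subfamilies of an i.i.d. sample are independent i.i.d. samples. -/
theorem MeasureTheory.measurePreserving_prod_comp_injective {Ω ι κ ι' : Type*} [MeasurableSpace Ω]
    [Fintype ι] [Fintype κ] [Fintype ι'] (P : Measure Ω) [IsProbabilityMeasure P]
    {e : ι ⊕ κ → ι'} (he : Function.Injective e) :
    MeasurePreserving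
      (fun S : ι' → Ω => ((fun i => S (e (.inl i)), fun k => S (e (.inr k))) : (ι → Ω) × (κ → Ω)))
      (Measure.pi fun _ => P) ((Measure.pi fun _ => P).prod (Measure.pi fun _ => P)) :=
  (measurePreserving_sumPiEquivProdPi (fun _ : ι ⊕ κ => P)).comp
    (measurePreserving_comp_injective P he)

namespace ScenarioProgram

variable {Ω E : Type*} [NormedAddCommGroup E] [NormedSpace ℝ E]
  (p : ScenarioProgram Ω E) {ι κ : Type*}

theorem compat_congr_range {y : ι → Ω} {y' : κ → Ω} (h : Set.range y = Set.range y') :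
    p.compat y = p.compat y' := by
  ext ω
  simp only [compat, Set.mem_ofPred_eq, p.sol_congr_range h]
  rw [← Set.forall_mem_range (f := y)
      (p := fun υ => p.g υ (p.sol y') < 0 → p.label ω < p.label υ), h, Set.forall_mem_range]

variable [MeasurableSpace Ω] [FiniteDimensional ℝ E] [MeasurableSpace E] [BorelSpace E]

section Measurable

variable (hg : ∀ x, Measurable fun ω => p.g ω x)

include hg in
theorem measurable_sol [Fintype ι] : Measurable fun y : ι → Ω => p.sol y := by
  have : ProperSpace E := FiniteDimensional.proper ℝ E
  -- The sum of positive parts encodes all constraints in one Carathéodory function.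
  have hiff : ∀ (y : ι → Ω) (x : E), ∑ i, max (p.g (y i) x) 0 ≤ 0 ↔ x ∈ p.feasible y := by
    intro y x
    have hnn : ∀ i ∈ Finset.univ, 0 ≤ max (p.g (y i) x) 0 := fun i _ => le_max_right _ _
    rw [show ∑ i, max (p.g (y i) x) 0 ≤ 0 ↔ ∑ i, max (p.g (y i) x) 0 = 0 from
      ⟨fun h => h.antisymm (Finset.sum_nonneg hnn), fun h => h.le⟩,
      Finset.sum_eq_zero_iff_of_nonneg hnn]
    simp [feasible]
  refine measurable_of_unique_minimizer
    (h := fun (y : ι → Ω) x => ∑ i, max (p.g (y i) x) 0) (φ := p.φ) ?_ ?_ p.continuous_φ 0 ?_ ?_ ?_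
  · intro x
    exact Finset.measurable_sum _ fun i _ => ((hg x).comp (measurable_pi_apply i)).max
      measurable_const
  · intro y
    exact continuous_finsetSum _ fun i _ => (p.continuous_g _).max continuous_const
  · rintro y ⟨x, hx⟩
    rw [hiff] at hx ⊢
    exact p.sol_mem ⟨x, hx⟩
  · intro y x hx hne
    rw [hiff] at hx
    exact p.sol_lt hx hne
  · intro y hy
    have : p.feasible y = ∅ := by
      rw [Set.eq_empty_iff_forall_notMem]
      exact fun x hx => hy ⟨x, (hiff y x).2 hx⟩
    rw [sol, this, argmin_empty]

include hg in
theorem measurable_g_sol {Z : Type*} [MeasurableSpace Z] [Fintype ι] {a : Z → Ω} {b : Z → ι → Ω}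
    (ha : Measurable a) (hb : Measurable b) : Measurable fun z => p.g (a z) (p.sol (b z)) := by
  have : ProperSpace E := FiniteDimensional.proper ℝ E
  have h1 : Measurable (Function.uncurry fun (x : E) (ω : Ω) => p.g ω x) :=
    measurable_uncurry_of_continuous_of_measurable (fun ω => p.continuous_g ω) hg
  exact h1.comp (((p.measurable_sol hg).comp hb).prodMk ha)

variable (hl : Measurable p.label)

include hg hl in
theorem measurableSet_compat [Fintype ι] :
    MeasurableSet {q : (ι → Ω) × Ω | q.2 ∈ p.compat q.1} := by
  have heq : {q : (ι → Ω) × Ω | q.2 ∈ p.compat q.1} =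
      {q | p.g q.2 (p.sol q.1) ≤ 0} ∩
        ⋂ i, ({q | p.g (q.1 i) (p.sol q.1) < 0}ᶜ ∪ {q | p.label q.2 < p.label (q.1 i)}) := by
    ext q
    simp [compat, imp_iff_not_or]
  rw [heq]
  refine (measurableSet_le (p.measurable_g_sol hg measurable_snd measurable_fst)
    measurable_const).inter (MeasurableSet.iInter fun i => ?_)
  exact (measurableSet_lt (p.measurable_g_sol hg (by fun_prop) measurable_fst)
    measurable_const).compl.union (measurableSet_lt (by fun_prop) (by fun_prop))

variable (P : Measure Ω) [IsProbabilityMeasure P]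

include hg hl in
theorem measurable_measure_compat [Fintype ι] : Measurable fun y : ι → Ω => P (p.compat y) :=
  measurable_measure_prodMk_left (p.measurableSet_compat hg hl)

-- The solution for `I` depends only on the samples in `I`, hence is independent of the sample j
-- outside. Conditionally on it, equality in constraint j is null; equal labels are excluded by the
-- same Fubini argument.
include hg in
theorem ae_isGeneric {m d : ℕ} (hg0 : ∀ x, P {ω | p.g ω x = 0} = 0)
    (hl : Measurable p.label) (hl0 : ∀ c, P {ω | p.label ω = c} = 0)
    (hfeas : ∀ᵐ S ∂(Measure.pi fun _ : Fin m => P), (p.feasible S).Nonempty) :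
    ∀ᵐ S ∂(Measure.pi fun _ : Fin m => P), p.IsGeneric S d := by
  have hcoord : ∀ (A : Set Ω), P A = 0 → (Measure.pi fun _ : Unit => P) {t | t () ∈ A} = 0 :=
    fun A hA => (measurePreserving_eval (fun _ : Unit => P) ()).quasiMeasurePreserving.preimage_null
      hA
  have h1 : ∀ᵐ S ∂(Measure.pi fun _ : Fin m => P), ∀ I : Finset (Fin m), ∀ j : Fin m,
      j ∉ I → p.g (S j) (p.sol (sub S I)) ≠ 0 := by
    rw [ae_all_iff]; intro I
    rw [ae_all_iff]; intro j
    by_cases hj : j ∈ I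
    · exact Filter.Eventually.of_forall fun S h => absurd hj h
    let e : I ⊕ Unit → Fin m := Sum.elim (fun i => i) fun _ => j
    have he : Function.Injective e := by
      rintro (a | a) (b | b) hab
      · exact congrArg _ (Subtype.ext hab)
      · exact absurd (show (a : Fin m) = j from hab) fun h => hj (h ▸ a.2)
      · exact absurd (show j = (b : Fin m) from hab) fun h => hj (h ▸ b.2)
      · rfl
    have hnull : ∀ᵐ q ∂((Measure.pi fun _ : I => P).prod (Measure.pi fun _ : Unit => P)),
        p.g (q.2 ()) (p.sol q.1) ≠ 0 := by
      have hms : MeasurableSet {q : (I → Ω) × (Unit → Ω) | p.g (q.2 ()) (p.sol q.1) = 0} :=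
        measurableSet_eq_fun (p.measurable_g_sol hg (by fun_prop) measurable_fst) measurable_const
      rw [ae_iff]
      simp only [ne_eq, not_not]
      rw [Measure.measure_prod_null hms]
      exact Filter.Eventually.of_forall fun y => hcoord {ω | p.g ω (p.sol y) = 0} (hg0 _)
    have := (measurePreserving_prod_comp_injective P he).quasiMeasurePreserving.ae hnull
    exact this.mono fun S hS _ => hS
  have h2 : ∀ᵐ S ∂(Measure.pi fun _ : Fin m => P), ∀ i j : Fin m,
      i ≠ j → p.label (S i) ≠ p.label (S j) := by
    rw [ae_all_iff]; intro i
    rw [ae_all_iff]; intro j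
    by_cases hij : i = j
    · exact Filter.Eventually.of_forall fun S h => absurd hij h
    let e : Unit ⊕ Unit → Fin m := Sum.elim (fun _ => i) fun _ => j
    have he : Function.Injective e := by
      rintro (a | a) (b | b) hab
      · rfl
      · exact absurd hab hij
      · exact absurd hab.symm hij
      · rfl
    have hnull : ∀ᵐ q ∂((Measure.pi fun _ : Unit => P).prod (Measure.pi fun _ : Unit => P)),
        p.label (q.1 ()) ≠ p.label (q.2 ()) := by
      have hms : MeasurableSet {q : (Unit → Ω) × (Unit → Ω) |
          p.label (q.1 ()) = p.label (q.2 ())} :=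
        measurableSet_eq_fun (by fun_prop) (by fun_prop)
      rw [ae_iff]
      simp only [ne_eq, not_not]
      rw [Measure.measure_prod_null hms]
      refine Filter.Eventually.of_forall fun y => hcoord {ω | p.label (y ()) = p.label ω} ?_
      simpa only [eq_comm] using hl0 (p.label (y ()))
    have := (measurePreserving_prod_comp_injective P he).quasiMeasurePreserving.ae hnull
    exact this.mono fun S hS _ => hS
  filter_upwards [hfeas, h1, h2] with S hS hS1 hS2
  exact ⟨hS, fun I _ j hj => hS1 I j hj, hS2⟩

-- Given the d samples y indexed by `I`, the other m - d are independent of them and each lies in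
-- `p.compat y` with probability `P (p.compat y)`; this explains the power in the integrand.
include hg hl in
theorem measure_compresses {m d : ℕ} {I : Finset (Fin m)} (hI : I.card = d)
    {W : Set ENNReal} (hW : MeasurableSet W) :
    MeasurableSet {S : Fin m → Ω | p.Compresses S I ∧ P (p.compat (sub S I)) ∈ W} ∧
    (Measure.pi fun _ : Fin m => P)
        {S | p.Compresses S I ∧ P (p.compat (sub S I)) ∈ W} =
      ∫⁻ y in {y : Fin d → Ω | P (p.compat y) ∈ W}, P (p.compat y) ^ (m - d)
        ∂(Measure.pi fun _ : Fin d => P) := by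
  have hIc : Iᶜ.card = m - d := by rw [Finset.card_compl, hI, Fintype.card_fin]
  let e : Fin d ⊕ Fin (m - d) ≃ Fin m := finSumEquivOfFinset hI hIc
  have hrange : ∀ S : Fin m → Ω,
      Set.range (sub S I) = Set.range fun i : Fin d => S (e (.inl i)) := by
    intro S
    ext ω
    simp only [Set.mem_range, Subtype.exists]
    constructor
    · rintro ⟨i, hi, rfl⟩
      rcases hk : e.symm i with k | k
      · exact ⟨k, by rw [← hk, e.apply_symm_apply]⟩
      · have : i ∈ Iᶜ := by
          rw [← e.apply_symm_apply i, hk, finSumEquivOfFinset_inr]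
          exact Finset.orderEmbOfFin_mem _ _ _
        exact absurd hi (Finset.mem_compl.1 this)
    · rintro ⟨k, rfl⟩
      exact ⟨e (.inl k), by
        rw [finSumEquivOfFinset_inl]; exact Finset.orderEmbOfFin_mem _ _ _, rfl⟩
  have hcompl : ∀ q : Fin m → Prop, (∀ j ∉ I, q j) ↔ ∀ k, q (e (.inr k)) := by
    intro q
    constructor
    · intro h k
      refine h _ (Finset.mem_compl.1 ?_)
      rw [finSumEquivOfFinset_inr]
      exact Finset.orderEmbOfFin_mem _ _ _
    · intro h j hj
      rcases hk : e.symm j with k | k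
      · have : j ∈ I := by
          rw [← e.apply_symm_apply j, hk, finSumEquivOfFinset_inl]
          exact Finset.orderEmbOfFin_mem _ _ _
        exact absurd this hj
      · have := h k
        rwa [← hk, e.apply_symm_apply] at this
  set B : Set ((Fin d → Ω) × (Fin (m - d) → Ω)) :=
    {q | P (p.compat q.1) ∈ W} ∩ ⋂ k, {q | q.2 k ∈ p.compat q.1} with hB
  have hWm : MeasurableSet {y : Fin d → Ω | P (p.compat y) ∈ W} :=
    p.measurable_measure_compat hg hl P hW
  have hBm : MeasurableSet B := by
    refine (measurable_fst hWm).inter (MeasurableSet.iInter fun k => ?_)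
    have : Measurable fun q : (Fin d → Ω) × (Fin (m - d) → Ω) => (q.1, q.2 k) := by fun_prop
    exact this (p.measurableSet_compat hg hl)
  have heq : {S : Fin m → Ω | p.Compresses S I ∧ P (p.compat (sub S I)) ∈ W} =
      (fun S : Fin m → Ω => ((fun i => S (e (.inl i)), fun k => S (e (.inr k))) :
        (Fin d → Ω) × (Fin (m - d) → Ω))) ⁻¹' B := by
    ext S
    simp only [Compresses, p.compat_congr_range (hrange S), hB, Set.mem_preimage,
      Set.mem_inter_iff, Set.mem_iInter, Set.mem_ofPred_eq]
    rw [hcompl fun j => S j ∈ _, and_comm]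
  have hmp := measurePreserving_prod_comp_injective P e.injective
  refine ⟨heq ▸ hmp.measurable hBm, ?_⟩
  rw [heq, hmp.measure_preimage hBm.nullMeasurableSet, Measure.prod_apply hBm,
    ← lintegral_indicator hWm]
  refine lintegral_congr fun y => ?_
  by_cases hy : P (p.compat y) ∈ W
  · have : Prod.mk y ⁻¹' B = Set.univ.pi fun _ => p.compat y := by
      ext t
      simp [hB, hy]
    rw [this, Measure.pi_pi, Set.indicator_of_mem (by exact hy)]
    simp
  · have : Prod.mk y ⁻¹' B = ∅ := by
      ext t
      simp [hB, hy]
    rw [this, Set.indicator_of_notMem (by exact hy)]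
    simp

end Measurable

/-- The violation probability of the solution of a random convex program in general position. -/
theorem measure_violation_le (P : Measure Ω) [IsProbabilityMeasure P]
    (hg : ∀ x, Measurable fun ω => p.g ω x) (hl : Measurable p.label)
    (hg0 : ∀ x, P {ω | p.g ω x = 0} = 0) (hl0 : ∀ c, P {ω | p.label ω = c} = 0)
    {d : ℕ} (hd : Module.finrank ℝ E = d) (hd0 : 0 < d)
    (hfeas : ∀ m, d ≤ m → ∀ᵐ S ∂(Measure.pi fun _ : Fin m => P), (p.feasible S).Nonempty)
    {M : ℕ} (hM : d ≤ M) {ε : ℝ} (hε : ε ∈ Set.Ioo (0 : ℝ) 1) :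
    (Measure.pi fun _ : Fin M => P).real
        {S | ε < P.real {ω | 0 < p.g ω (p.sol S)}} ≤
      ∑ l ∈ Finset.range d, (M.choose l : ℝ) * ε ^ l * (1 - ε) ^ (M - l) := by
  have hwm := p.measurable_measure_compat (ι := Fin d) hg hl P
  have hwr : Measurable fun y : Fin d → Ω => P.real (p.compat y) := hwm.ennreal_toReal
  have hgen : ∀ m, d ≤ m → ∀ᵐ S ∂(Measure.pi fun _ : Fin m => P),
      ∃! I : Finset (Fin m), I.card = d ∧ p.Compresses S I := by
    intro m hm
    filter_upwards [p.ae_isGeneric hg P (d := d) hg0 hl hl0 (hfeas m hm)] with S hS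
    subst hd
    exact hS.existsUnique_compresses p (by simpa using hm)
  set F : Measure ℝ := (Measure.pi fun _ : Fin d => P).map fun y => P.real (p.compat y) with hF
  have : IsProbabilityMeasure F := Measure.isProbabilityMeasure_map hwr.aemeasurable
  have hF01 : ∀ᵐ w ∂F, w ∈ Set.Icc (0 : ℝ) 1 := by
    refine (ae_map_iff hwr.aemeasurable (p := fun w => w ∈ Set.Icc (0 : ℝ) 1)
      measurableSet_Icc).2 ?_
    exact Filter.Eventually.of_forall fun y => ⟨measureReal_nonneg, measureReal_le_one⟩
  have hFint : ∀ (s : Set ℝ), MeasurableSet s → ∀ k : ℕ, ∫ w in s, w ^ k ∂F =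
      (∫⁻ y in {y : Fin d → Ω | P (p.compat y) ∈ ENNReal.toReal ⁻¹' s}, P (p.compat y) ^ k
        ∂(Measure.pi fun _ : Fin d => P)).toReal := by
    intro s hs k
    rw [hF, setIntegral_map hs (by fun_prop) hwr.aemeasurable,
      ← integral_toReal (hwm.pow_const k).aemeasurable]
    · simp only [ENNReal.toReal_pow]; rfl
    · exact Filter.Eventually.of_forall fun y => ENNReal.pow_lt_top (measure_lt_top _ _)
  have hmom : ∀ k : ℕ, ((k + d).choose d : ℝ) * ∫ w, w ^ k ∂F = 1 := by
    intro k
    -- Almost surely exactly one `I` compresses, so these events partition the sample space up to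
    -- null sets, and all have the same probability.
    have hsum : ∑ I ∈ Finset.powersetCard d (Finset.univ : Finset (Fin (k + d))),
        (Measure.pi fun _ : Fin (k + d) => P)
          {S | p.Compresses S I ∧ P (p.compat (sub S I)) ∈ Set.univ} = 1 := by
      rw [← measure_biUnion_finset₀]
      · rw [← measure_univ (μ := Measure.pi fun _ : Fin (k + d) => P)]
        refine measure_congr (Filter.eventuallyEq_univ.2 ?_)
        filter_upwards [hgen (k + d) (by omega)] with S hS
        obtain ⟨I, ⟨hI, hc⟩, -⟩ := hS
        exact Set.mem_iUnion₂.2 ⟨I, Finset.mem_powersetCard.2 ⟨Finset.subset_univ _, hI⟩,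
          hc, trivial⟩
      · intro I hI J hJ hIJ
        refine measure_eq_zero_iff_ae_notMem.2 ?_
        filter_upwards [hgen (k + d) (by omega)] with S hS hmem
        exact hIJ (hS.unique ⟨(Finset.mem_powersetCard.1 hI).2, hmem.1.1⟩
          ⟨(Finset.mem_powersetCard.1 hJ).2, hmem.2.1⟩)
      · intro I hI
        exact (p.measure_compresses hg hl P (Finset.mem_powersetCard.1 hI).2
          MeasurableSet.univ).1.nullMeasurableSet
    rw [Finset.sum_congr rfl fun I hI => (p.measure_compresses hg hl P
      (Finset.mem_powersetCard.1 hI).2 MeasurableSet.univ).2, Finset.sum_const,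
      Finset.card_powersetCard, Finset.card_univ, Fintype.card_fin, Nat.add_sub_cancel] at hsum
    have h1 := hFint Set.univ MeasurableSet.univ k
    rw [setIntegral_univ] at h1
    rw [h1]
    have h2 := congrArg ENNReal.toReal hsum
    simpa using h2
  have h1ε : 1 - ε ∈ Set.Icc (0 : ℝ) 1 := ⟨by linarith [hε.2], by linarith [hε.1]⟩
  have hfinal := choose_mul_setIntegral_pow_eq hF01 hd0 hmom hM h1ε
  rw [sub_sub_cancel] at hfinal
  rw [← hfinal, hFint _ measurableSet_Iio]
  set W : Set ENNReal := ENNReal.toReal ⁻¹' Set.Iio (1 - ε) with hW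
  have hWm : MeasurableSet W := ENNReal.measurable_toReal measurableSet_Iio
  -- The compression set has the solution of the whole sample, and compatible samples do not violate
  -- it; violation above ε thus puts the compatible mass below 1 - ε.
  have hle : (Measure.pi fun _ : Fin M => P) {S | ε < P.real {ω | 0 < p.g ω (p.sol S)}} ≤
      (M.choose d : ENNReal) * ∫⁻ y in {y : Fin d → Ω | P (p.compat y) ∈ W},
        P (p.compat y) ^ (M - d) ∂(Measure.pi fun _ : Fin d => P) := by
    calc (Measure.pi fun _ : Fin M => P) {S | ε < P.real {ω | 0 < p.g ω (p.sol S)}}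
        ≤ (Measure.pi fun _ : Fin M => P)
          (⋃ I ∈ Finset.powersetCard d (Finset.univ : Finset (Fin M)),
            {S | p.Compresses S I ∧ P (p.compat (sub S I)) ∈ W}) := by
          refine measure_mono_ae ?_
          filter_upwards [hgen M hM, hfeas M hM] with S hS hne hv
          obtain ⟨I, ⟨hI, hc⟩, -⟩ := hS
          refine Set.mem_iUnion₂.2 ⟨I, Finset.mem_powersetCard.2 ⟨Finset.subset_univ _, hI⟩,
            hc, ?_⟩
          have hsol := hc.sol_eq p hne
          have hsub : p.compat (sub S I) ⊆ {ω | 0 < p.g ω (p.sol S)}ᶜ := by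
            intro ω hω
            have := hω.1
            rw [hsol] at this
            exact not_lt.2 this
          have hgm : MeasurableSet {ω | 0 < p.g ω (p.sol S)} :=
            measurableSet_lt measurable_const (hg _)
          have h1 := measureReal_mono (μ := P) hsub
          rw [probReal_compl_eq_one_sub hgm] at h1
          have h2 : ε < P.real {ω | 0 < p.g ω (p.sol S)} := hv
          change P.real (p.compat (sub S I)) < 1 - ε
          linarith
      _ ≤ ∑ I ∈ Finset.powersetCard d (Finset.univ : Finset (Fin M)),
          (Measure.pi fun _ : Fin M => P)
            {S | p.Compresses S I ∧ P (p.compat (sub S I)) ∈ W} :=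
          measure_biUnion_finset_le _ _
      _ = _ := by
          rw [Finset.sum_congr rfl fun I hI => (p.measure_compresses hg hl P
            (Finset.mem_powersetCard.1 hI).2 hWm).2, Finset.sum_const,
            Finset.card_powersetCard, Finset.card_univ, Fintype.card_fin, nsmul_eq_mul]
  have hfin : ∫⁻ y in {y : Fin d → Ω | P (p.compat y) ∈ W},
        P (p.compat y) ^ (M - d) ∂(Measure.pi fun _ : Fin d => P) ≠ ⊤ := by
    refine ne_top_of_le_ne_top ENNReal.one_ne_top ?_
    calc _ ≤ ∫⁻ y in {y : Fin d → Ω | P (p.compat y) ∈ W}, 1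
          ∂(Measure.pi fun _ : Fin d => P) :=
          lintegral_mono fun y => pow_le_one₀ zero_le prob_le_one
      _ ≤ 1 := by simpa using prob_le_one
  have := ENNReal.toReal_mono (ENNReal.mul_ne_top (by simp) hfin) hle
  rwa [ENNReal.toReal_mul, ENNReal.toReal_natCast] at this

end ScenarioProgram

/-! ### Removing general position by random thickening -/

section Convergence

open Filter Topology

/-- Bounds on a continuous function along a sequence pass to cluster points. -/
theorem MapClusterPt.le_of_eventually_le {X : Type*} [TopologicalSpace X] {x : ℕ → X} {y : X}
    (hy : MapClusterPt y atTop x) {f : X → ℝ} (hf : Continuous f) {c : ℕ → ℝ} {c₀ : ℝ}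
    (hc : Tendsto c atTop (𝓝 c₀)) (hle : ∀ᶠ n in atTop, f (x n) ≤ c n) : f y ≤ c₀ := by
  by_contra! hlt
  obtain ⟨r, hr, hr'⟩ := exists_between hlt
  have h1 := hy.frequently ((hf.tendsto y).eventually_const_lt hr')
  obtain ⟨n, hn, hn', hn''⟩ := (h1.and_eventually (hle.and (hc.eventually_lt_const hr))).exists
  linarith

theorem isCompact_setOf_le_of_tendsto_cocompact {E : Type*} [TopologicalSpace E] {φ : E → ℝ}
    (hφ : Continuous φ) (hco : Tendsto φ (cocompact E) atTop) (c : ℝ) :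
    IsCompact {x | φ x ≤ c} := by
  obtain ⟨K, hK, hsub⟩ := mem_cocompact.1 (hco.eventually_gt_atTop c)
  refine hK.of_isClosed_subset (isClosed_le hφ continuous_const) fun x hx => ?_
  by_contra hxK
  have : c < φ x := hsub hxK
  exact this.not_ge hx

end Convergence

theorem Convex.setOf_infDist_le {E : Type*} [NormedAddCommGroup E] [NormedSpace ℝ E] {C : Set E}
    (hC : Convex ℝ C) (hne : C.Nonempty) (r : ℝ) : Convex ℝ {x | Metric.infDist x C ≤ r} := by
  rcases lt_or_ge r 0 with hr | hr
  · have : {x | Metric.infDist x C ≤ r} = ∅ := by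
      ext x
      simpa using hr.trans_le Metric.infDist_nonneg
    rw [this]; exact convex_empty
  · have : {x | Metric.infDist x C ≤ r} = Metric.cthickening r C := by
      ext x
      rw [Metric.mem_cthickening_iff, ENNReal.le_ofReal_iff_toReal_le
        (Metric.infEDist_ne_top hne) hr]
      rfl
    rw [this]; exact hC.cthickening r

/-- A measurable family of nonempty closed convex sets. -/
structure RandomConvexSet (Z E : Type*) [MeasurableSpace Z] [NormedAddCommGroup E]
    [NormedSpace ℝ E] where
  /-- the sets -/
  carrier : Z → Set E
  isClosed : ∀ z, IsClosed (carrier z)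
  convex : ∀ z, Convex ℝ (carrier z)
  nonempty : ∀ z, (carrier z).Nonempty
  measurable_infDist : ∀ x, Measurable fun z => Metric.infDist x (carrier z)

/-- A continuous, coercive and strictly convex objective. -/
structure IsStrictObjective {E : Type*} [NormedAddCommGroup E] [NormedSpace ℝ E]
    (φ : E → ℝ) : Prop where
  continuous : Continuous φ
  coercive : Filter.Tendsto φ (Filter.cocompact E) Filter.atTop
  strictConvex : StrictConvexOn ℝ Set.univ φ

namespace RandomConvexSet

open Filter Topology

variable {Z E : Type*} [MeasurableSpace Z] [NormedAddCommGroup E] [NormedSpace ℝ E]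
  (Y : RandomConvexSet Z E) {φ : E → ℝ} (hφ : IsStrictObjective φ)

theorem mem_iff (z : Z) (x : E) : x ∈ Y.carrier z ↔ Metric.infDist x (Y.carrier z) ≤ 0 := by
  rw [(Y.isClosed z).mem_iff_infDist_zero (Y.nonempty z)]
  exact ⟨fun h => h.le, fun h => h.antisymm Metric.infDist_nonneg⟩

/-- The convex program whose constraints are the sets of `Y`. -/
noncomputable def program : ScenarioProgram Z E where
  g z x := Metric.infDist x (Y.carrier z)
  φ := φ
  label _ := 0
  continuous_g _ := Metric.continuous_infDist_pt _
  convex_g z := (Y.convex z).setOf_infDist_le (Y.nonempty z) 0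
  continuous_φ := hφ.continuous
  coercive_φ := hφ.coercive
  strictConvex_φ := hφ.strictConvex
  label_mem _ := by simp

/-- The convex program in which the sets of `Y` are thickened at random, by at most `ρ`. -/
noncomputable def heated (ρ : ℝ) : ScenarioProgram (Z × unitInterval) E where
  g ω x := Metric.infDist x (Y.carrier ω.1) - ρ * ω.2
  φ := φ
  label ω := ω.2
  continuous_g _ := (Metric.continuous_infDist_pt _).sub continuous_const
  convex_g ω := by
    simpa only [sub_nonpos] using (Y.convex ω.1).setOf_infDist_le (Y.nonempty ω.1) _
  continuous_φ := hφ.continuous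
  coercive_φ := hφ.coercive
  strictConvex_φ := hφ.strictConvex
  label_mem ω := ω.2.2

theorem program_feasible {ι : Type*} (S : ι → Z) :
    (Y.program hφ).feasible S = ⋂ i, Y.carrier (S i) := by
  ext x
  simp only [ScenarioProgram.feasible, Set.mem_ofPred_eq, Set.mem_iInter, Y.mem_iff]
  rfl

theorem program_feasible_subset {ι : Type*} {ρ : ℝ} (hρ : 0 ≤ ρ) (S : ι → Z × unitInterval) :
    (Y.program hφ).feasible (fun i => (S i).1) ⊆ (Y.heated hφ ρ).feasible S := by
  intro x hx i
  have h1 : Metric.infDist x (Y.carrier (S i).1) ≤ 0 := hx i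
  change Metric.infDist x (Y.carrier (S i).1) - ρ * (S i).2 ≤ 0
  have := mul_nonneg hρ (S i).2.2.1
  linarith

/-- Thickening enlarges the feasible set, so the solutions stay in a compact sublevel set of the
original optimum. Any cluster point is feasible in the limit and no worse, hence equals that
optimum. -/
theorem tendsto_heated_sol {ι : Type*} (S : ι → Z × unitInterval)
    (hS : ((Y.program hφ).feasible fun i => (S i).1).Nonempty) {ρ : ℕ → ℝ} (hρ : ∀ n, 0 ≤ ρ n)
    (hlim : Tendsto ρ atTop (𝓝 0)) :
    Tendsto (fun n => (Y.heated hφ (ρ n)).sol S) atTop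
      (𝓝 ((Y.program hφ).sol fun i => (S i).1)) := by
  set T : ι → Z := fun i => (S i).1
  set x := (Y.program hφ).sol T with hx
  have hle : ∀ n, φ ((Y.heated hφ (ρ n)).sol S) ≤ φ x := by
    intro n
    by_cases h : x = (Y.heated hφ (ρ n)).sol S
    · rw [h]
    · exact ((Y.heated hφ (ρ n)).sol_lt (Y.program_feasible_subset hφ (hρ n) S
        ((Y.program hφ).sol_mem hS)) h).le
  refine (isCompact_setOf_le_of_tendsto_cocompact hφ.continuous hφ.coercive
    (φ x)).tendsto_nhds_of_unique_mapClusterPt (Eventually.of_forall hle) fun y _ hy => ?_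
  have hyφ : φ y ≤ φ x :=
    hy.le_of_eventually_le hφ.continuous tendsto_const_nhds (Eventually.of_forall hle)
  have hyf : y ∈ (Y.program hφ).feasible T := by
    intro i
    refine hy.le_of_eventually_le (Metric.continuous_infDist_pt _) hlim
      (Eventually.of_forall fun n => ?_)
    have h1 : Metric.infDist ((Y.heated hφ (ρ n)).sol S) (Y.carrier (S i).1) -
        ρ n * (S i).2 ≤ 0 := (Y.heated hφ (ρ n)).sol_mem
      (hS.mono (Y.program_feasible_subset hφ (hρ n) S)) i
    have h2 := mul_le_of_le_one_right (hρ n) (S i).2.2.2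
    linarith
  by_contra hne
  exact absurd ((Y.program hφ).sol_lt hyf hne) (not_lt.2 hyφ)

variable [FiniteDimensional ℝ E] [MeasurableSpace E] [BorelSpace E] (Q : Measure Z) [IsProbabilityMeasure Q]

include hφ in
/-- The violation probability of the solution of a random convex program. -/
theorem measure_violation_le {d : ℕ} (hd : Module.finrank ℝ E = d) (hd0 : 0 < d)
    (hfeas : ∀ m, d ≤ m → ∀ᵐ S ∂(Measure.pi fun _ : Fin m => Q),
      (⋂ i, Y.carrier (S i)).Nonempty)
    {M : ℕ} (hM : d ≤ M) {ε : ℝ} (hε : ε ∈ Set.Ioo (0 : ℝ) 1) :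
    (Measure.pi fun _ : Fin M => Q).real
        {S | ε < Q.real {z | argmin φ (⋂ i, Y.carrier (S i)) ∉ Y.carrier z}} ≤
      ∑ l ∈ Finset.range d, (M.choose l : ℝ) * ε ^ l * (1 - ε) ^ (M - l) := by
  set P : Measure (Z × unitInterval) := Q.prod volume with hP
  set b := ∑ l ∈ Finset.range d, (M.choose l : ℝ) * ε ^ l * (1 - ε) ^ (M - l)
  have hb0 : 0 ≤ b := Finset.sum_nonneg fun l _ => by
    have h1 := hε.1.le
    have h2 : 0 ≤ 1 - ε := by linarith [hε.2]
    positivity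
  set ρ : ℕ → ℝ := fun n => 1 / ((n : ℝ) + 1) with hρ
  have hρ0 : ∀ n, 0 < ρ n := fun n => Nat.one_div_pos_of_nat
  have hρlim : Tendsto ρ atTop (𝓝 0) := tendsto_one_div_add_atTop_nhds_zero_nat
  have hfst : MeasurePreserving (Prod.fst : Z × unitInterval → Z) P Q :=
    measurePreserving_fst
  have hpi : ∀ m, MeasurePreserving (fun (S : Fin m → Z × unitInterval) i => (S i).1)
      (Measure.pi fun _ => P) (Measure.pi fun _ => Q) := fun m =>
    measurePreserving_pi (fun _ => P) (fun _ => Q) fun _ => hfst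
  have hfeasΩ : ∀ m, d ≤ m → ∀ᵐ S ∂(Measure.pi fun _ : Fin m => P),
      ((Y.program hφ).feasible fun i => (S i).1).Nonempty := by
    intro m hm
    have := (hpi m).quasiMeasurePreserving.ae (hfeas m hm)
    exact this.mono fun S hS => by rwa [program_feasible]
  have hgm : ∀ n x, Measurable fun ω => (Y.heated hφ (ρ n)).g ω x := fun n x =>
    ((Y.measurable_infDist x).comp measurable_fst).sub
      (measurable_const.mul (measurable_subtype_coe.comp measurable_snd))
  have hlm : ∀ n, Measurable (Y.heated hφ (ρ n)).label := fun n =>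
    measurable_subtype_coe.comp measurable_snd
  -- For fixed z each level of `f` is hit by at most one u in [0, 1], a null set. With ρ > 0 this
  -- applies both to the thickened constraint and to the label.
  have hsection : ∀ f : Z × unitInterval → ℝ, Measurable f →
      (∀ z, (f ∘ Prod.mk z).Injective) → ∀ c, P {ω | f ω = c} = 0 := by
    intro f hf hinj c
    rw [hP, Measure.measure_prod_null (measurableSet_eq_fun hf measurable_const)]
    refine Eventually.of_forall fun z => Set.Subsingleton.measure_zero ?_ _
    intro u hu v hv
    exact hinj z (hu.trans hv.symm)
  have hbound : ∀ n, (Measure.pi fun _ : Fin M => P)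
      {S | ε < P.real {ω | 0 < (Y.heated hφ (ρ n)).g ω ((Y.heated hφ (ρ n)).sol S)}} ≤
      ENNReal.ofReal b := by
    intro n
    rw [ENNReal.le_ofReal_iff_toReal_le (measure_ne_top _ _) hb0]
    refine (Y.heated hφ (ρ n)).measure_violation_le P (hgm n) (hlm n) (fun x => ?_) ?_ hd hd0 ?_
      hM hε
    · refine hsection _ (hgm n x) (fun z u v huv => ?_) 0
      have huv' : Metric.infDist x (Y.carrier z) - ρ n * u =
        Metric.infDist x (Y.carrier z) - ρ n * v := huv
      exact Subtype.ext (mul_left_cancel₀ (hρ0 n).ne' (by linarith))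
    · exact hsection _ (hlm n) fun z u v huv => Subtype.ext huv
    · intro m hm
      exact (hfeasΩ m hm).mono fun S hS => hS.mono (Y.program_feasible_subset hφ (hρ0 n).le S)
  have hV : ∀ x, {z | x ∉ Y.carrier z} = {z | 0 < (Y.program hφ).g z x} := by
    intro x
    ext z
    simp only [Set.mem_ofPred_eq, Y.mem_iff, not_le]
    rfl
  have hset : {S : Fin M → Z | ε < Q.real {z | argmin φ (⋂ i, Y.carrier (S i)) ∉ Y.carrier z}} =
      {S | ε < Q.real {z | 0 < (Y.program hφ).g z ((Y.program hφ).sol S)}} := by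
    ext S
    simp only [hV, ← Y.program_feasible hφ]
    rfl
  have hBm : MeasurableSet
      {S : Fin M → Z | ε < Q.real {z | 0 < (Y.program hφ).g z ((Y.program hφ).sol S)}} := by
    refine measurableSet_lt measurable_const (Measurable.ennreal_toReal ?_)
    refine measurable_measure_prodMk_left (s := {q : (Fin M → Z) × Z |
      0 < (Y.program hφ).g q.2 ((Y.program hφ).sol q.1)}) (measurableSet_lt measurable_const ?_)
    exact (Y.program hφ).measurable_g_sol (fun x => Y.measurable_infDist x) measurable_snd
      measurable_fst
  rw [hset, measureReal_def, ← (hpi M).measure_preimage hBm.nullMeasurableSet,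
    ← ENNReal.le_ofReal_iff_toReal_le (measure_ne_top _ _) hb0]
  -- Fatou is used twice: on samples, to pass the bound to the limit, and below on fresh
  -- constraints, to see that a violation above ε persists for all large n.
  refine measure_le_of_eventually_mem ?_ (Frequently.of_forall hbound)
  filter_upwards [hfeasΩ M hM] with S hS hSε
  have hlim := Y.tendsto_heated_sol hφ S hS (fun n => (hρ0 n).le) hρlim
  set x := (Y.program hφ).sol fun i => (S i).1 with hx
  by_contra hfreq
  rw [not_eventually] at hfreq
  have hle : P {ω | 0 < (Y.program hφ).g ω.1 x} ≤ ENNReal.ofReal ε := by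
    refine measure_le_of_eventually_mem
      (C := fun n => {ω | 0 < (Y.heated hφ (ρ n)).g ω ((Y.heated hφ (ρ n)).sol S)})
      (Eventually.of_forall fun ω hω => ?_) (hfreq.mono fun n hn => ?_)
    · have h1 : Tendsto (fun n => Metric.infDist ((Y.heated hφ (ρ n)).sol S) (Y.carrier ω.1) -
          ρ n * ω.2) atTop (𝓝 (Metric.infDist x (Y.carrier ω.1) - 0 * ω.2)) :=
        (((Metric.continuous_infDist_pt _).tendsto x).comp hlim).sub (hρlim.mul_const _)
      rw [zero_mul, sub_zero] at h1
      exact h1.eventually_const_lt hω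
    · rw [ENNReal.le_ofReal_iff_toReal_le (measure_ne_top _ _) hε.1.le]
      exact not_lt.1 hn
  have hmeas : MeasurableSet {z | 0 < (Y.program hφ).g z x} :=
    measurableSet_lt measurable_const (Y.measurable_infDist x)
  have heq : P {ω | 0 < (Y.program hφ).g ω.1 x} = Q {z | 0 < (Y.program hφ).g z x} :=
    hfst.measure_preimage hmeas.nullMeasurableSet
  rw [heq, ENNReal.le_ofReal_iff_toReal_le (measure_ne_top _ _) hε.1.le] at hle
  exact absurd hSε (not_lt.2 hle)

end RandomConvexSet

/-! ### Tikhonov regularization of the lexicographic objective -/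

section Tikhonov

open Filter Topology

variable {W : Type*} [NormedAddCommGroup W]

/-- The regularized objective `δ² + τ ‖β‖²`. -/
def tikhonov (τ : ℝ) (q : W × ℝ) : ℝ := q.2 ^ 2 + τ * ‖q.1‖ ^ 2

theorem mul_norm_sq_add_mul_norm_sq_sub [InnerProductSpace ℝ W] (x y : W) {a b : ℝ}
    (hab : a + b = 1) :
    a * ‖x‖ ^ 2 + b * ‖y‖ ^ 2 - ‖a • x + b • y‖ ^ 2 = a * b * ‖x - y‖ ^ 2 := by
  rw [norm_add_sq_real, norm_sub_sq_real, norm_smul, norm_smul, real_inner_smul_left,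
    real_inner_smul_right, mul_pow, mul_pow, Real.norm_eq_abs, Real.norm_eq_abs, sq_abs, sq_abs]
  obtain rfl : b = 1 - a := by linarith
  ring

theorem isStrictObjective_tikhonov [InnerProductSpace ℝ W] [FiniteDimensional ℝ W] {τ : ℝ} (hτ : 0 < τ) :
    IsStrictObjective (tikhonov τ : W × ℝ → ℝ) where
  continuous := by unfold tikhonov; fun_prop
  coercive := by
    have : ProperSpace W := FiniteDimensional.proper ℝ W
    have h1 : Tendsto (fun q : W × ℝ => min 1 τ * ‖q‖ ^ 2) (cocompact (W × ℝ)) atTop :=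
      ((tendsto_pow_atTop two_ne_zero).comp
        (tendsto_norm_cocompact_atTop (E := W × ℝ))).const_mul_atTop (lt_min one_pos hτ)
    refine tendsto_atTop_mono (fun q => ?_) h1
    have h2 : min 1 τ ≤ 1 := min_le_left _ _
    have h3 : min 1 τ ≤ τ := min_le_right _ _
    have h4 : 0 < min 1 τ := lt_min one_pos hτ
    unfold tikhonov
    rcases max_choice ‖q.1‖ ‖q.2‖ with h | h
    · rw [Prod.norm_def, h]
      nlinarith [sq_nonneg q.2, sq_nonneg ‖q.1‖]
    · rw [Prod.norm_def, h, Real.norm_eq_abs, sq_abs]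
      nlinarith [sq_nonneg q.2, mul_nonneg hτ.le (sq_nonneg ‖q.1‖)]
  strictConvex := by
    refine ⟨convex_univ, fun x _ y _ hxy a b ha hb hab => ?_⟩
    have h1 := mul_norm_sq_add_mul_norm_sq_sub x.1 y.1 hab
    have h2 : a * x.2 ^ 2 + b * y.2 ^ 2 - (a * x.2 + b * y.2) ^ 2 = a * b * (x.2 - y.2) ^ 2 := by
      obtain rfl : b = 1 - a := by linarith
      ring
    have h3 : 0 < a * b * (x.2 - y.2) ^ 2 + τ * (a * b * ‖x.1 - y.1‖ ^ 2) := by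
      by_cases h : x.2 = y.2
      · have : x.1 - y.1 ≠ 0 := fun h' => hxy (Prod.ext (sub_eq_zero.1 h') h)
        have : 0 < ‖x.1 - y.1‖ := norm_pos_iff.2 this
        positivity
      · have : x.2 - y.2 ≠ 0 := sub_ne_zero.2 h
        have : 0 < (x.2 - y.2) ^ 2 := by positivity
        positivity
    simp only [tikhonov, Prod.fst_add, Prod.snd_add, Prod.smul_fst, Prod.smul_snd, smul_eq_mul]
    nlinarith

/-- `x` minimizes `|δ|` over `K` and has the least `‖β‖` among the minimizers. -/
def IsLexMin (K : Set (W × ℝ)) (x : W × ℝ) : Prop :=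
  x ∈ K ∧ ∀ y ∈ K, |x.2| ≤ |y.2| ∧ (|y.2| = |x.2| → ‖x.1‖ ≤ ‖y.1‖)

/-- If y ≠ x, their midpoint is feasible, has |δ| no larger, hence equal to that of x, and then its
‖β‖ is at least that of x. This contradicts strict convexity of δ² + ‖β‖². -/
theorem IsLexMin.eq_of_le [InnerProductSpace ℝ W] [FiniteDimensional ℝ W]
    {K : Set (W × ℝ)} {x y : W × ℝ}
    (h : IsLexMin K x) (hK : Convex ℝ K) (hy : y ∈ K) (h2 : |y.2| ≤ |x.2|)
    (h1 : ‖y.1‖ ≤ ‖x.1‖) : y = x := by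
  by_contra hne
  have hmid : (1 / 2 : ℝ) • y + (1 / 2 : ℝ) • x ∈ K :=
    hK hy h.1 (by norm_num) (by norm_num) (by norm_num)
  have hlt := (isStrictObjective_tikhonov (W := W) one_pos).strictConvex.2 (Set.mem_univ y)
    (Set.mem_univ x) hne (by norm_num : (0 : ℝ) < 1 / 2) (by norm_num : (0 : ℝ) < 1 / 2)
    (by norm_num)
  set m := (1 / 2 : ℝ) • y + (1 / 2 : ℝ) • x with hm
  have hm2 : |m.2| ≤ |x.2| := by
    have : m.2 = 1 / 2 * y.2 + 1 / 2 * x.2 := by simp [hm]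
    rw [this]
    refine (abs_add_le _ _).trans ?_
    rw [abs_mul, abs_mul, abs_of_pos (by norm_num : (0 : ℝ) < 1 / 2)]
    linarith
  obtain ⟨hle, heq⟩ := h.2 m hmid
  have hn := heq (hm2.antisymm hle)
  have e1 := sq_le_sq.2 hle
  have e2 := sq_le_sq.2 h2
  have e3 : ‖x.1‖ ^ 2 ≤ ‖m.1‖ ^ 2 := by gcongr
  have e4 : ‖y.1‖ ^ 2 ≤ ‖x.1‖ ^ 2 := by gcongr
  simp only [tikhonov, smul_eq_mul] at hlt
  linarith

/-- The regularized solutions converge to the lexicographic solution. -/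
theorem IsLexMin.tendsto_argmin [InnerProductSpace ℝ W] [FiniteDimensional ℝ W]
    {K : Set (W × ℝ)} {x : W × ℝ} (h : IsLexMin K x) (hK : Convex ℝ K) (hcl : IsClosed K)
    {τ : ℕ → ℝ} (hτ : ∀ n, 0 < τ n) (hlim : Tendsto τ atTop (𝓝 0)) :
    Tendsto (fun n => argmin (tikhonov (τ n)) K) atTop (𝓝 x) := by
  have hφ := fun n => isStrictObjective_tikhonov (W := W) (hτ n)
  have hspec := fun n => argmin_spec (hφ n).continuous (hφ n).coercive hcl ⟨x, h.1⟩
  have hle : ∀ n, tikhonov (τ n) (argmin (tikhonov (τ n)) K) ≤ tikhonov (τ n) x :=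
    fun n => (hspec n).2 h.1
  set s : ℕ → W × ℝ := fun n => argmin (tikhonov (τ n)) K with hs
  have hδ : ∀ n, x.2 ^ 2 ≤ (s n).2 ^ 2 := fun n => sq_le_sq.2 (h.2 _ (hspec n).1).1
  -- The regularized solution has no smaller δ², so its smaller objective can come only from ‖β‖.
  have hβ : ∀ n, ‖(s n).1‖ ^ 2 ≤ ‖x.1‖ ^ 2 := by
    intro n
    have h1 : (s n).2 ^ 2 + τ n * ‖(s n).1‖ ^ 2 ≤ x.2 ^ 2 + τ n * ‖x.1‖ ^ 2 := hle n
    have h2 := hδ n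
    exact le_of_mul_le_mul_left (by linarith) (hτ n)
  have hδ' : ∀ n, (s n).2 ^ 2 ≤ x.2 ^ 2 + τ n * ‖x.1‖ ^ 2 := by
    intro n
    have h1 : (s n).2 ^ 2 + τ n * ‖(s n).1‖ ^ 2 ≤ x.2 ^ 2 + τ n * ‖x.1‖ ^ 2 := hle n
    have h2 := mul_nonneg (hτ n).le (sq_nonneg ‖(s n).1‖)
    linarith
  have hclim : Tendsto (fun n => x.2 ^ 2 + τ n * ‖x.1‖ ^ 2) atTop (𝓝 (x.2 ^ 2)) := by
    simpa using (hlim.mul_const (‖x.1‖ ^ 2)).const_add (x.2 ^ 2)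
  have hcpt := isCompact_setOf_le_of_tendsto_cocompact
    (isStrictObjective_tikhonov (W := W) one_pos).continuous
    (isStrictObjective_tikhonov (W := W) one_pos).coercive (x.2 ^ 2 + 1 + ‖x.1‖ ^ 2)
  refine hcpt.tendsto_nhds_of_unique_mapClusterPt ?_ fun y _ hy => ?_
  · filter_upwards [hclim.eventually_lt_const (lt_add_one _)] with n hn
    have h1 := hβ n
    have h2 := hδ' n
    change (s n).2 ^ 2 + 1 * ‖(s n).1‖ ^ 2 ≤ _
    linarith
  · have hyK : y ∈ K := by
      rw [hcl.mem_iff_infDist_zero ⟨x, h.1⟩]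
      refine le_antisymm (hy.le_of_eventually_le (Metric.continuous_infDist_pt _)
        tendsto_const_nhds (Eventually.of_forall fun n => ?_)) Metric.infDist_nonneg
      rw [Metric.infDist_zero_of_mem (hspec n).1]
    have hy2 : y.2 ^ 2 ≤ x.2 ^ 2 := hy.le_of_eventually_le
      (f := fun q : W × ℝ => q.2 ^ 2) (by fun_prop) hclim (Eventually.of_forall hδ')
    have hy1 : ‖y.1‖ ^ 2 ≤ ‖x.1‖ ^ 2 := hy.le_of_eventually_le
      (f := fun q : W × ℝ => ‖q.1‖ ^ 2) (by fun_prop) tendsto_const_nhds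
      (Eventually.of_forall hβ)
    exact h.eq_of_le hK hyK (sq_le_sq.1 hy2) (by
      simpa using sq_le_sq.1 hy1)

end Tikhonov

/-! ### Lexicographic bound and feasibility for all sample sizes -/

namespace RandomConvexSet

open Filter Topology

variable {Z : Type*} [MeasurableSpace Z] {N : ℕ} (Y : RandomConvexSet Z (Weights N × ℝ))
  (Q : Measure Z) [IsProbabilityMeasure Q]

/-- The violation probability of the lexicographic solution of a random convex program. -/
theorem measure_violation_lexMin_le
    (hfeas : ∀ m, N + 1 ≤ m → ∀ᵐ S ∂(Measure.pi fun _ : Fin m => Q),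
      (⋂ i, Y.carrier (S i)).Nonempty)
    {M : ℕ} (hM : N + 1 ≤ M) {x : (Fin M → Z) → Weights N × ℝ}
    (hx : ∀ᵐ S ∂(Measure.pi fun _ : Fin M => Q), IsLexMin (⋂ i, Y.carrier (S i)) (x S))
    {ε : ℝ} (hε : ε ∈ Set.Ioo (0 : ℝ) 1) :
    (Measure.pi fun _ : Fin M => Q).real {S | ε < Q.real {z | x S ∉ Y.carrier z}} ≤
      ∑ l ∈ Finset.range (N + 1), (M.choose l : ℝ) * ε ^ l * (1 - ε) ^ (M - l) := by
  set b := ∑ l ∈ Finset.range (N + 1), (M.choose l : ℝ) * ε ^ l * (1 - ε) ^ (M - l)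
  have hb0 : 0 ≤ b := Finset.sum_nonneg fun l _ => by
    have h1 := hε.1.le
    have h2 : 0 ≤ 1 - ε := by linarith [hε.2]
    positivity
  set τ : ℕ → ℝ := fun n => 1 / ((n : ℝ) + 1) with hτ
  have hτ0 : ∀ n, 0 < τ n := fun n => Nat.one_div_pos_of_nat
  have hτlim : Tendsto τ atTop (𝓝 0) := tendsto_one_div_add_atTop_nhds_zero_nat
  have hrank : Module.finrank ℝ (Weights N × ℝ) = N + 1 := by simp
  rw [measureReal_def, ← ENNReal.le_ofReal_iff_toReal_le (measure_ne_top _ _) hb0]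
  -- No measurability of `x` is needed here, since the Fatou lemma accepts arbitrary sets.
  refine measure_le_of_eventually_mem
    (C := fun n => {S | ε < Q.real {z | argmin (tikhonov (τ n)) (⋂ i, Y.carrier (S i)) ∉
      Y.carrier z}}) ?_ (Frequently.of_forall fun n => ?_)
  · filter_upwards [hx] with S hS hSε
    have hlim := hS.tendsto_argmin (convex_iInter fun i => Y.convex _)
      (isClosed_iInter fun i => Y.isClosed _) hτ0 hτlim
    by_contra hfreq
    rw [not_eventually] at hfreq
    have hle : Q {z | x S ∉ Y.carrier z} ≤ ENNReal.ofReal ε := by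
      refine measure_le_of_eventually_mem
        (C := fun n => {z | argmin (tikhonov (τ n)) (⋂ i, Y.carrier (S i)) ∉ Y.carrier z})
        (Eventually.of_forall fun z hz => ?_) (hfreq.mono fun n hn => ?_)
      · exact hlim.eventually ((Y.isClosed z).isOpen_compl.mem_nhds hz)
      · rw [ENNReal.le_ofReal_iff_toReal_le (measure_ne_top _ _) hε.1.le]
        exact not_lt.1 hn
    rw [ENNReal.le_ofReal_iff_toReal_le (measure_ne_top _ _) hε.1.le] at hle
    exact absurd hSε (not_lt.2 hle)
  · rw [ENNReal.le_ofReal_iff_toReal_le (measure_ne_top _ _) hb0]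
    exact Y.measure_violation_le (isStrictObjective_tikhonov (hτ0 n)) Q hrank N.succ_pos hfeas
      hM hε

/-- Feasibility of a random program that is upward closed in the last variable extends from one
sample size above the dimension to all of them. -/
theorem ae_nonempty_iInter
    (hup : ∀ z β δ δ', (β, δ) ∈ Y.carrier z → δ ≤ δ' → (β, δ') ∈ Y.carrier z)
    {M : ℕ} (hM : N + 1 ≤ M)
    (h : ∀ᵐ S ∂(Measure.pi fun _ : Fin M => Q), (⋂ i, Y.carrier (S i)).Nonempty)
    {m : ℕ} (hm : N + 1 ≤ m) :
    ∀ᵐ S ∂(Measure.pi fun _ : Fin m => Q), (⋂ i, Y.carrier (S i)).Nonempty := by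
  have hbase : ∀ᵐ y ∂(Measure.pi fun _ : Fin (N + 1) => Q),
      (⋂ i, Y.carrier (y i)).Nonempty := by
    have hms : MeasurableSet {y : Fin (N + 1) → Z | (⋂ i, Y.carrier (y i)).Nonempty} := by
      have heq : {y : Fin (N + 1) → Z | (⋂ i, Y.carrier (y i)).Nonempty} =
          {y | ∃ x ∈ Set.univ, ∑ i, Metric.infDist x (Y.carrier (y i)) ≤ 0} := by
        ext y
        simp only [Set.mem_ofPred_eq, Set.mem_univ, true_and, Set.Nonempty, Set.mem_iInter,
          Y.mem_iff]
        refine exists_congr fun x => ⟨fun H => Finset.sum_nonpos fun i _ => H i, fun H i => ?_⟩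
        exact (Finset.single_le_sum (f := fun i => Metric.infDist x (Y.carrier (y i)))
          (fun i _ => Metric.infDist_nonneg) (Finset.mem_univ i)).trans H
      rw [heq]
      exact isClosed_univ.measurableSet_exists_mem_le_zero
        (fun x => Finset.measurable_sum _ fun i _ =>
          (Y.measurable_infDist x).comp (measurable_pi_apply i))
        fun y => continuous_finsetSum _ fun i _ => Metric.continuous_infDist_pt _
    have hmp := measurePreserving_comp_injective Q (Fin.castLE_injective hM)
    rw [← hmp.map_eq, ae_map_iff hmp.measurable.aemeasurable hms]
    filter_upwards [h] with S hS
    obtain ⟨x, hx⟩ := hS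
    exact ⟨x, Set.mem_iInter.2 fun i => Set.mem_iInter.1 hx _⟩
  have hsub : ∀ᵐ S ∂(Measure.pi fun _ : Fin m => Q), ∀ I : Finset (Fin m),
      I.card = N + 1 → (⋂ i ∈ I, Y.carrier (S i)).Nonempty := by
    rw [ae_all_iff]; intro I
    by_cases hI : I.card = N + 1
    · have hmp := measurePreserving_comp_injective Q (I.orderEmbOfFin hI).injective
      filter_upwards [hmp.quasiMeasurePreserving.ae hbase] with S hS _
      obtain ⟨x, hx⟩ := hS
      refine ⟨x, Set.mem_iInter₂.2 fun i hi => ?_⟩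
      have : i ∈ Set.range (I.orderEmbOfFin hI) := by
        rw [Finset.range_orderEmbOfFin]; exact hi
      obtain ⟨k, rfl⟩ := this
      exact Set.mem_iInter.1 hx k
    · exact Eventually.of_forall fun S h => absurd h hI
  filter_upwards [hsub] with S hS
  have hrank : Module.finrank ℝ (Weights N) = N := by simp
  -- Helly is applied to the projections to β-space, of dimension N, where groups of N + 1 sets
  -- suffice; in (β, δ)-space it would need N + 2. Raising δ then restores a common point.
  obtain ⟨β, hβ⟩ := Convex.helly_theorem (𝕜 := ℝ) (s := (Finset.univ : Finset (Fin m)))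
    (F := fun i => (LinearMap.fst ℝ (Weights N) ℝ) '' Y.carrier (S i))
    (by rw [hrank]; simpa using hm) (fun i _ => (Y.convex _).linear_image _) (by
      intro I _ hI
      rw [hrank] at hI
      obtain ⟨x, hx⟩ := hS I hI
      exact ⟨x.1, Set.mem_iInter₂.2 fun i hi => ⟨x, Set.mem_iInter₂.1 hx i hi, rfl⟩⟩)
  have hβ' : ∀ i, ∃ δ, (β, δ) ∈ Y.carrier (S i) := by
    intro i
    obtain ⟨x, hx, rfl⟩ := Set.mem_iInter₂.1 hβ i (Finset.mem_univ i)
    exact ⟨x.2, hx⟩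
  choose δ hδ using hβ'
  obtain ⟨D, hD⟩ := (Set.finite_range δ).bddAbove
  exact ⟨(β, D), Set.mem_iInter.2 fun i => hup _ _ _ _ (hδ i) (hD ⟨i, rfl⟩)⟩

end RandomConvexSet

/-! ### Closedness and measurability of the game's constraint sets -/

namespace AggregativeGame

variable {N n : ℕ} (G : AggregativeGame N n)

theorem continuous_gradient_fst (i : Fin N) :
    Continuous fun q : Vec n × Vec n => gradient (fun u => G.J i u q.2) q.1 := by
  have hf := G.contDiff_J i
  have heq : (fun q : Vec n × Vec n => gradient (fun u => G.J i u q.2) q.1) = fun q =>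
      (InnerProductSpace.toDual ℝ (Vec n)).symm
        ((fderiv ℝ (fun p : Vec n × Vec n => G.J i p.1 p.2) q).comp
          (ContinuousLinearMap.inl ℝ (Vec n) (Vec n))) := by
    ext1 q
    have h1 : HasFDerivAt (fun u => G.J i u q.2) _ q.1 :=
      HasFDerivAt.comp (g := fun p : Vec n × Vec n => G.J i p.1 p.2) (f := fun u => (u, q.2)) q.1
        ((hf.differentiable one_ne_zero) (q.1, q.2)).hasFDerivAt
        (hasFDerivAt_prodMk_left q.1 q.2)
    rw [gradient, h1.fderiv]
  rw [heq]
  exact (LinearIsometryEquiv.continuous _).comp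
    ((hf.continuous_fderiv one_ne_zero).clm_comp continuous_const)

theorem continuous_gradient_snd (i : Fin N) :
    Continuous fun q : Vec n × Vec n => gradient (fun s => G.J i q.1 s) q.2 := by
  have hf := G.contDiff_J i
  have heq : (fun q : Vec n × Vec n => gradient (fun s => G.J i q.1 s) q.2) = fun q =>
      (InnerProductSpace.toDual ℝ (Vec n)).symm
        ((fderiv ℝ (fun p : Vec n × Vec n => G.J i p.1 p.2) q).comp
          (ContinuousLinearMap.inr ℝ (Vec n) (Vec n))) := by
    ext1 q
    have h1 : HasFDerivAt (fun s => G.J i q.1 s) _ q.2 :=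
      HasFDerivAt.comp (g := fun p : Vec n × Vec n => G.J i p.1 p.2) (f := fun s => (q.1, s)) q.2
        ((hf.differentiable one_ne_zero) (q.1, q.2)).hasFDerivAt
        (hasFDerivAt_prodMk_right q.1 q.2)
    rw [gradient, h1.fderiv]
  rw [heq]
  exact (LinearIsometryEquiv.continuous _).comp
    ((hf.continuous_fderiv one_ne_zero).clm_comp continuous_const)

theorem continuous_pseudoGradient (i : Fin N) :
    Continuous fun q : Weights N × Profile N n => G.pseudoGradient q.1 q.2 i := by
  have hσ : Continuous fun q : Weights N × Profile N n => (q.2 i, aggregator q.1 q.2) := by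
    unfold aggregator; fun_prop
  have hβ : Continuous fun q : Weights N × Profile N n => q.1 i := by fun_prop
  exact ((G.continuous_gradient_fst i).comp hσ).add
    (hβ.smul ((G.continuous_gradient_snd i).comp hσ))

/-- The amount by which the constraints of the inverse problem are violated, for the data
`q = (α, x)` and the variables `v = ((β, δ), γ)`. -/
noncomputable def slack (q : Profile N n × Profile N n) (v : (Weights N × ℝ) × ℝ) : ℝ :=
  max ((∑ i, inner ℝ (G.pseudoGradient v.1.1 q.2 i) (q.2 i)) - v.2 * G.b - v.1.2) 0 +
    (max v.2 0 + ∑ i, ∑ l, max (-(G.pseudoGradient v.1.1 q.2 i l - v.2 * q.1 i l)) 0)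

theorem slack_nonpos_iff (q : Profile N n × Profile N n) (v : (Weights N × ℝ) × ℝ) :
    G.slack q v ≤ 0 ↔ G.InverseConstraint q.1 q.2 v.1.1 v.2 v.1.2 := by
  unfold slack InverseConstraint
  constructor
  · intro h
    have h1 := le_max_right
      ((∑ i, inner ℝ (G.pseudoGradient v.1.1 q.2 i) (q.2 i)) - v.2 * G.b - v.1.2) 0
    have h2 := le_max_right v.2 0
    have h3 : ∀ i, 0 ≤ ∑ l, max (-(G.pseudoGradient v.1.1 q.2 i l - v.2 * q.1 i l)) 0 :=
      fun i => Finset.sum_nonneg fun l _ => le_max_right _ _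
    have h4 := Finset.sum_nonneg fun i (_ : i ∈ Finset.univ) => h3 i
    refine ⟨?_, ?_, fun i l => ?_⟩
    · have := le_max_left
        ((∑ i, inner ℝ (G.pseudoGradient v.1.1 q.2 i) (q.2 i)) - v.2 * G.b - v.1.2) 0
      linarith
    · have := le_max_left v.2 0
      linarith
    · have h5 := Finset.single_le_sum (fun i _ => h3 i) (Finset.mem_univ i)
      have h6 := Finset.single_le_sum
        (f := fun l => max (-(G.pseudoGradient v.1.1 q.2 i l - v.2 * q.1 i l)) 0)
        (fun l _ => le_max_right _ _) (Finset.mem_univ l)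
      have h7 := le_max_left (-(G.pseudoGradient v.1.1 q.2 i l - v.2 * q.1 i l)) 0
      simp only at h5 h6
      linarith
  · rintro ⟨h1, h2, h3⟩
    rw [max_eq_right (by linarith), max_eq_right h2, Finset.sum_eq_zero fun i _ =>
      Finset.sum_eq_zero fun l _ => max_eq_right (neg_nonpos.2 (h3 i l))]
    simp

theorem continuous_slack :
    Continuous fun p : (Profile N n × Profile N n) × ((Weights N × ℝ) × ℝ) =>
      G.slack p.1 p.2 := by
  have hF : ∀ i, Continuous fun p : (Profile N n × Profile N n) × ((Weights N × ℝ) × ℝ) =>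
      G.pseudoGradient p.2.1.1 p.1.2 i := fun i =>
    (G.continuous_pseudoGradient i).comp
      (f := fun p : (Profile N n × Profile N n) × ((Weights N × ℝ) × ℝ) => (p.2.1.1, p.1.2))
      (by fun_prop)
  have hF' : ∀ i l, Continuous fun p : (Profile N n × Profile N n) × ((Weights N × ℝ) × ℝ) =>
      G.pseudoGradient p.2.1.1 p.1.2 i l := fun i l => by
    have := hF i
    fun_prop
  unfold slack
  fun_prop

theorem continuous_slack_right (q : Profile N n × Profile N n) : Continuous (G.slack q) :=
  G.continuous_slack.comp (f := fun v => (q, v)) (by fun_prop)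

theorem constraintSet_upward {α x : Profile N n} {β : Weights N} {δ δ' : ℝ}
    (h : (β, δ) ∈ G.constraintSet α x) (hle : δ ≤ δ') : (β, δ') ∈ G.constraintSet α x := by
  obtain ⟨γ, h1, h2⟩ := h
  exact ⟨γ, h1.trans hle, h2⟩

/-- A nonempty interior yields a point that satisfies the coupling constraint strictly. -/
theorem exists_strict_of_interior_nonempty {α : Profile N n} (hα : α ≠ 0)
    (h : (interior (G.couplingSet α)).Nonempty) :
    ∃ y : Profile N n, (∀ i l, 0 ≤ y i l) ∧ ∑ i, inner ℝ (α i) (y i) < G.b := by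
  obtain ⟨y, hy⟩ := h
  refine ⟨y, (interior_subset hy).1, ?_⟩
  -- Moving from an interior point in direction α increases the resource use by t‖α‖² without
  -- leaving the set, so the inequality was strict.
  have hcont : Continuous fun t : ℝ => y + t • α := by fun_prop
  have hev : ∀ᶠ t : ℝ in nhdsWithin 0 (Set.Ioi 0), y + t • α ∈ interior (G.couplingSet α) := by
    refine Filter.Eventually.filter_mono nhdsWithin_le_nhds ?_
    refine hcont.continuousAt.eventually (isOpen_interior.mem_nhds ?_)
    simpa using hy
  obtain ⟨t, ht, ht0⟩ := (hev.and self_mem_nhdsWithin).exists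
  have h1 := (interior_subset ht).2
  simp only [Pi.add_apply, Pi.smul_apply, inner_add_right, inner_smul_right,
    Finset.sum_add_distrib, ← Finset.mul_sum, real_inner_self_eq_norm_sq] at h1
  have h2 : 0 < ∑ i, ‖α i‖ ^ 2 := by
    obtain ⟨i, hi⟩ := Function.ne_iff.1 hα
    refine Finset.sum_pos' (fun _ _ => by positivity) ⟨i, Finset.mem_univ i, ?_⟩
    have : 0 < ‖α i‖ := norm_pos_iff.2 hi
    positivity
  have h3 : 0 < t := ht0
  have := mul_pos h3 h2
  linarith

/-- A projection along γ is closed once γ is bounded. Pairing Fᵢ - γ αᵢ ≥ 0 with a strictly feasible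
y ≥ 0 gives -γ (b - ∑ αᵢᵀ yᵢ) ≤ δ - Fᵀx + Fᵀy, a bound continuous in (β, δ). -/
theorem isClosed_constraintSet {α : Profile N n} (h : (interior (G.couplingSet α)).Nonempty)
    (x : Profile N n) : IsClosed (G.constraintSet α x) := by
  have hslack := G.continuous_slack_right (α, x)
  -- For α = 0 a strict point may be missing, as b = 0 is possible; but b ≥ 0 makes γ = 0 the best
  -- multiplier.
  by_cases hα : α = 0
  · have hb : 0 ≤ G.b := by
      obtain ⟨y, hy⟩ := h
      simpa [hα] using (interior_subset hy).2
    have heq : G.constraintSet α x = {p | G.slack (α, x) (p, 0) ≤ 0} := by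
      ext p
      simp only [Set.mem_ofPred_eq, slack_nonpos_iff]
      constructor
      · rintro ⟨γ, h1, h2, h3⟩
        refine ⟨?_, le_rfl, ?_⟩
        · have := mul_nonneg (neg_nonneg.2 h2) hb
          linarith
        · simpa [hα] using h3
      · exact fun h => ⟨0, h⟩
    rw [heq]
    exact isClosed_le (hslack.comp (by fun_prop)) continuous_const
  · obtain ⟨y, hy0, hy⟩ := G.exists_strict_of_interior_nonempty hα h
    set c := G.b - ∑ i, inner ℝ (α i) (y i) with hc
    have hc0 : 0 < c := sub_pos.2 hy
    let f : Weights N → Profile N n → ℝ := fun β z => ∑ i, inner ℝ (G.pseudoGradient β x i) (z i)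
    let R : Weights N × ℝ → ℝ := fun p => max ((p.2 - f p.1 x + f p.1 y) / c) 0
    have hF : ∀ i, Continuous fun p : Weights N × ℝ => G.pseudoGradient p.1 x i := fun i =>
      (G.continuous_pseudoGradient i).comp (f := fun p : Weights N × ℝ => (p.1, x))
        (by fun_prop)
    have hR : Continuous R := by
      have hf : ∀ z, Continuous fun p : Weights N × ℝ => f p.1 z := fun z => by
        simp only [f]; fun_prop
      exact (((continuous_snd.sub (hf x)).add (hf y)).div_const c).max continuous_const
    have hbound : ∀ p γ, G.InverseConstraint α x p.1 γ p.2 → -γ ≤ R p := by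
      rintro p γ ⟨h1, h2, h3⟩
      refine le_max_of_le_left ((le_div_iff₀ hc0).2 ?_)
      have h4 : γ * ∑ i, inner ℝ (α i) (y i) ≤ f p.1 y := by
        simp only [f, Finset.mul_sum, PiLp.inner_apply, RCLike.inner_apply, conj_trivial]
        refine Finset.sum_le_sum fun i _ => Finset.sum_le_sum fun l _ => ?_
        have h5 := mul_nonneg (hy0 i l) (h3 i l)
        linarith
      have h1' : f p.1 x - γ * G.b ≤ p.2 := h1
      rw [hc, mul_sub]
      linarith
    -- Writing γ = -t R(p) with t in [0, 1] turns the set into a projection along a compact factor,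
    -- which preserves closedness.
    have heq : G.constraintSet α x = Prod.fst ''
        {q : (Weights N × ℝ) × unitInterval | G.slack (α, x) (q.1, -(q.2 * R q.1)) ≤ 0} := by
      ext p
      simp only [Set.mem_image, Set.mem_ofPred_eq, slack_nonpos_iff]
      constructor
      · rintro ⟨γ, hγ⟩
        have h1 := hbound p γ hγ
        have h2 : 0 ≤ -γ := neg_nonneg.2 hγ.2.1
        by_cases hR0 : R p = 0
        · refine ⟨(p, 0), ?_, rfl⟩
          have : γ = 0 := by linarith
          simpa [this] using hγ
        · have hRpos : 0 < R p := lt_of_le_of_ne (le_max_right _ _) (Ne.symm hR0)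
          refine ⟨(p, ⟨-γ / R p, div_nonneg h2 hRpos.le, (div_le_one hRpos).2 h1⟩), ?_, rfl⟩
          simpa only [div_mul_cancel₀ _ hR0, neg_neg] using hγ
      · rintro ⟨q, hq, rfl⟩
        exact ⟨_, hq⟩
    rw [heq]
    refine isClosedMap_fst_of_compactSpace _ (isClosed_le (hslack.comp ?_) continuous_const)
    fun_prop

theorem isClosed_uncertainty : IsClosed G.uncertainty := by
  simp only [uncertainty, Set.ofPred_forall]
  refine isClosed_iInter fun i => isClosed_iInter fun r => isClosed_le ?_ continuous_const
  fun_prop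

/-- The constraint set of a data point, restricted to nonnegative bounds `δ`. -/
def nonnegConstraintSet (α x : Profile N n) : Set (Weights N × ℝ) :=
  G.constraintSet α x ∩ {p | 0 ≤ p.2}

theorem measurableSet_exists_mem_nonnegConstraintSet {xstar : Profile N n → Profile N n}
    (hxstar : Measurable xstar) {F : Set (Weights N × ℝ)} (hF : IsClosed F) :
    MeasurableSet {α | ∃ p ∈ F, p ∈ G.nonnegConstraintSet α (xstar α)} := by
  have heq : {α | ∃ p ∈ F, p ∈ G.nonnegConstraintSet α (xstar α)} =
      {α | ∃ v ∈ {v : (Weights N × ℝ) × ℝ | v.1 ∈ F ∧ 0 ≤ v.1.2},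
        G.slack (α, xstar α) v ≤ 0} := by
    ext α
    simp only [Set.mem_ofPred_eq, slack_nonpos_iff, nonnegConstraintSet, Set.mem_inter_iff]
    constructor
    · rintro ⟨p, hp, ⟨γ, hγ⟩, h0⟩
      exact ⟨(p, γ), ⟨hp, h0⟩, hγ⟩
    · rintro ⟨⟨p, γ⟩, ⟨hp, h0⟩, hγ⟩
      exact ⟨p, hp, ⟨γ, hγ⟩, h0⟩
  rw [heq]
  refine IsClosed.measurableSet_exists_mem_le_zero ?_ (fun v => ?_) fun α =>
    G.continuous_slack_right _
  · exact (hF.preimage continuous_fst).inter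
      (isClosed_le continuous_const (continuous_snd.comp continuous_fst))
  · have h1 : Continuous fun q => G.slack q v :=
      G.continuous_slack.comp (f := fun q => (q, v)) (by fun_prop)
    exact h1.measurable.comp (measurable_id.prodMk hxstar)

open Classical in
/-- The constraint sets of the inverse problem as a random convex set. -/
noncomputable def randomConstraint
    (hslater : ∀ α ∈ G.uncertainty, (interior (G.couplingSet α)).Nonempty)
    (xstar : Profile N n → Profile N n) (hxstar : Measurable xstar)
    (hconvex : ∀ α ∈ G.uncertainty, Convex ℝ (G.constraintSet α (xstar α))) :
    RandomConvexSet (Profile N n) (Weights N × ℝ) where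
  -- Elsewhere closedness, convexity or nonemptiness may fail, so the whole space is substituted; in
  -- the theorem this happens only on a `Q`-null set.
  carrier α := if α ∈ G.uncertainty ∧ (G.nonnegConstraintSet α (xstar α)).Nonempty then
    G.nonnegConstraintSet α (xstar α) else Set.univ
  isClosed α := by
    split_ifs with h
    · exact (G.isClosed_constraintSet (hslater α h.1) _).inter
        (isClosed_le continuous_const continuous_snd)
    · exact isClosed_univ
  convex α := by
    split_ifs with h
    · exact (hconvex α h.1).inter
        (convex_halfSpace_ge (f := Prod.snd) (LinearMap.snd ℝ (Weights N) ℝ).isLinear 0)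
    · exact convex_univ
  nonempty α := by
    split_ifs with h
    · exact h.2
    · exact Set.univ_nonempty
  measurable_infDist x := by
    have hA := G.isClosed_uncertainty.measurableSet
    have hne : MeasurableSet {α | (G.nonnegConstraintSet α (xstar α)).Nonempty} := by
      simpa [Set.Nonempty] using
        G.measurableSet_exists_mem_nonnegConstraintSet hxstar isClosed_univ
    refine measurable_of_Iic fun r => ?_
    -- The distance to a nonempty closed set is attained in finite dimension, so it is at most r iff
    -- the closed ball of radius r meets the set.
    have heq : (fun α => Metric.infDist x
        (if α ∈ G.uncertainty ∧ (G.nonnegConstraintSet α (xstar α)).Nonempty then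
          G.nonnegConstraintSet α (xstar α) else Set.univ)) ⁻¹' Set.Iic r =
        ((G.uncertainty ∩ {α | (G.nonnegConstraintSet α (xstar α)).Nonempty}) ∩
          {α | ∃ p ∈ Metric.closedBall x r, p ∈ G.nonnegConstraintSet α (xstar α)}) ∪
        ((G.uncertainty ∩ {α | (G.nonnegConstraintSet α (xstar α)).Nonempty})ᶜ ∩
          {_α | 0 ≤ r}) := by
      ext α
      simp only [Set.mem_preimage, Set.mem_Iic, Set.mem_union, Set.mem_inter_iff,
        Set.mem_ofPred_eq, Set.mem_compl_iff]
      split_ifs with h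
      · simp only [h, and_self, true_and, not_true_eq_false, false_and, or_false]
        have hcl : IsClosed (G.nonnegConstraintSet α (xstar α)) :=
          (G.isClosed_constraintSet (hslater α h.1) _).inter
            (isClosed_le continuous_const continuous_snd)
        constructor
        · intro hr
          obtain ⟨p, hp, hd⟩ := hcl.exists_infDist_eq_dist h.2 x
          exact ⟨p, by rw [Metric.mem_closedBall, dist_comm, ← hd]; exact hr, hp⟩
        · rintro ⟨p, hp, hpc⟩
          rw [Metric.mem_closedBall, dist_comm] at hp
          exact (Metric.infDist_le_dist_of_mem hpc).trans hp
      · simp [h, Metric.infDist_zero_of_mem (Set.mem_univ x)]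
    rw [heq]
    exact ((hA.inter hne).inter (G.measurableSet_exists_mem_nonnegConstraintSet hxstar
      Metric.isClosed_closedBall)).union ((hA.inter hne).compl.inter (MeasurableSet.const _))

theorem randomConstraint_eq
    {hslater : ∀ α ∈ G.uncertainty, (interior (G.couplingSet α)).Nonempty}
    {xstar : Profile N n → Profile N n} {hxstar : Measurable xstar}
    {hconvex : ∀ α ∈ G.uncertainty, Convex ℝ (G.constraintSet α (xstar α))}
    {α : Profile N n} (hα : α ∈ G.uncertainty)
    (hne : (G.nonnegConstraintSet α (xstar α)).Nonempty) :
    (G.randomConstraint hslater xstar hxstar hconvex).carrier α =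
      G.nonnegConstraintSet α (xstar α) :=
  if_pos ⟨hα, hne⟩

theorem IsLearned.mem_nonnegConstraintSet {xstar : Profile N n → Profile N n} {M : ℕ}
    {α : Fin M → Profile N n} {β : Weights N} {δ : ℝ} (h : G.IsLearned xstar α β δ) (k : Fin M) :
    (β, δ) ∈ G.nonnegConstraintSet (α k) (xstar (α k)) := by
  obtain ⟨⟨γ, η, hf, rfl⟩, -⟩ := h
  exact ⟨G.constraintSet_upward ⟨γ k, hf k⟩ ((le_abs_self _).trans (norm_le_pi_norm η k)),
    norm_nonneg η⟩

/-- A common pair (β', δ') with δ' ≥ 0 becomes a feasible point by taking every η[k] = δ' and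
choosing γ[k] separately. Since M > 0, its norm is δ'. -/
theorem IsLearned.isLexMin {xstar : Profile N n → Profile N n} {M : ℕ} (hM : 0 < M)
    {α : Fin M → Profile N n} {β : Weights N} {δ : ℝ} (h : G.IsLearned xstar α β δ) :
    IsLexMin (⋂ k, G.nonnegConstraintSet (α k) (xstar (α k))) (β, δ) := by
  refine ⟨Set.mem_iInter.2 (h.mem_nonnegConstraintSet G), ?_⟩
  rintro ⟨β', δ'⟩ hy
  have hy' := Set.mem_iInter.1 hy
  have : Nonempty (Fin M) := ⟨⟨0, hM⟩⟩
  have hδ : 0 ≤ δ := (h.mem_nonnegConstraintSet G ⟨0, hM⟩).2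
  have hδ' : 0 ≤ δ' := (hy' ⟨0, hM⟩).2
  choose γ' hγ' using fun k => (hy' k).1
  have hnorm : ‖(fun _ : Fin M => δ')‖ = δ' := by
    rw [pi_norm_const, Real.norm_eq_abs, abs_of_nonneg hδ']
  have h2 := h.2 β' γ' (fun _ => δ') hγ'
  rw [hnorm] at h2
  rw [abs_of_nonneg hδ, abs_of_nonneg hδ']
  exact h2

end AggregativeGame

theorem theorem3 {N n : ℕ} (G : AggregativeGame N n)
    -- the coupling sets have nonempty interior for every parameter in the uncertainty set
    (hslater : ∀ α ∈ G.uncertainty, (interior (G.couplingSet α)).Nonempty)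
    -- the computed equilibria, as a function of the parameter
    (xstar : Profile N n → Profile N n) (hxstar : Measurable xstar)
    -- the constraint sets of all data points are convex
    (hconvex : ∀ α ∈ G.uncertainty, Convex ℝ (G.constraintSet α (xstar α)))
    -- the sampling distribution, an arbitrary probability law on the uncertainty set
    (Q : Measure (Profile N n)) [IsProbabilityMeasure Q] (hQ : ∀ᵐ α ∂Q, α ∈ G.uncertainty)
    -- the optimal solution learned from `M` i.i.d. samples, which exists almost surely
    (M : ℕ) (βstar : (Fin M → Profile N n) → Weights N) (δstar : (Fin M → Profile N n) → ℝ)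
    (hopt : ∀ᵐ α ∂(Measure.pi fun _ : Fin M => Q),
      G.IsLearned xstar α (βstar α) (δstar α))
    (ε : ℝ) (hε : ε ∈ Set.Ioo (0 : ℝ) 1) :
    (Measure.pi fun _ : Fin M => Q).real
        {α | ε < G.violation xstar Q (βstar α) (δstar α)} ≤
      ∑ l ∈ Finset.range (N + 1), (M.choose l : ℝ) * ε ^ l * (1 - ε) ^ (M - l) := by
  -- For M ≤ N the right-hand side is the full binomial sum, equal to 1.
  rcases Nat.lt_or_ge M (N + 1) with hMN | hMN
  · have hsum : ∑ l ∈ Finset.range (N + 1), (M.choose l : ℝ) * ε ^ l * (1 - ε) ^ (M - l) = 1 := by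
      have h1 : ∑ l ∈ Finset.range (M + 1), (M.choose l : ℝ) * ε ^ l * (1 - ε) ^ (M - l) = 1 := by
        have h2 := add_pow ε (1 - ε) M
        rw [add_sub_cancel, one_pow] at h2
        refine Eq.trans ?_ h2.symm
        exact Finset.sum_congr rfl fun l _ => by ring
      refine Eq.trans ?_ h1
      refine (Finset.sum_subset (Finset.range_subset_range.2 (by omega : M + 1 ≤ N + 1))
        fun l _ hl => ?_).symm
      rw [Nat.choose_eq_zero_of_lt (by simpa [Nat.lt_succ_iff] using hl)]
      simp
    rw [hsum]
    exact measureReal_le_one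
  have hM0 : 0 < M := by omega
  let Y := G.randomConstraint hslater xstar hxstar hconvex
  have hQM : ∀ᵐ S ∂(Measure.pi fun _ : Fin M => Q), ∀ k, S k ∈ G.uncertainty :=
    ae_all_iff.2 fun k => (measurePreserving_eval (fun _ : Fin M => Q) k).quasiMeasurePreserving.ae
      hQ
  -- Almost sure solvability for M samples makes the constraint set of a single sample nonempty
  -- almost surely, by passing to one marginal.
  have hne : ∀ᵐ α ∂Q, (G.nonnegConstraintSet α (xstar α)).Nonempty := by
    have hms : MeasurableSet {α | (G.nonnegConstraintSet α (xstar α)).Nonempty} := by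
      simpa [Set.Nonempty] using
        G.measurableSet_exists_mem_nonnegConstraintSet hxstar isClosed_univ
    have hmp := measurePreserving_eval (fun _ : Fin M => Q) ⟨0, hM0⟩
    rw [← hmp.map_eq, ae_map_iff hmp.measurable.aemeasurable hms]
    exact hopt.mono fun S hS => ⟨_, hS.mem_nonnegConstraintSet G ⟨0, hM0⟩⟩
  have hlex : ∀ᵐ S ∂(Measure.pi fun _ : Fin M => Q),
      IsLexMin (⋂ k, Y.carrier (S k)) (βstar S, δstar S) := by
    filter_upwards [hQM, hopt] with S hS hSopt
    have := hSopt.isLexMin G hM0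
    rwa [show ⋂ k, Y.carrier (S k) = ⋂ k, G.nonnegConstraintSet (S k) (xstar (S k)) from
      Set.iInter_congr fun k =>
        G.randomConstraint_eq (hS k) ⟨_, hSopt.mem_nonnegConstraintSet G k⟩]
  have hup : ∀ α β δ δ', (β, δ) ∈ Y.carrier α → δ ≤ δ' → (β, δ') ∈ Y.carrier α := by
    intro α β δ δ' h hle
    by_cases hα : α ∈ G.uncertainty ∧ (G.nonnegConstraintSet α (xstar α)).Nonempty
    · have heq : Y.carrier α = _ := G.randomConstraint_eq hα.1 hα.2
      rw [heq] at h ⊢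
      exact ⟨G.constraintSet_upward h.1 hle, le_trans h.2 hle⟩
    · have : Y.carrier α = Set.univ := if_neg hα
      rw [this]; trivial
  have hfeas := fun m (hm : N + 1 ≤ m) => Y.ae_nonempty_iInter Q hup hMN
    (hlex.mono fun S hS => ⟨_, hS.1⟩) hm
  refine le_trans ?_ (Y.measure_violation_lexMin_le Q hfeas hMN hlex hε)
  refine ENNReal.toReal_mono (measure_ne_top _ _) (measure_mono_ae ?_)
  filter_upwards [hopt] with S hS hSε
  refine lt_of_lt_of_le hSε (ENNReal.toReal_mono (measure_ne_top _ _) (measure_mono_ae ?_))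
  filter_upwards [hne] with α hα hv hmem
  have heq : Y.carrier α = _ := G.randomConstraint_eq hv.1 hα
  rw [heq] at hmem
  exact hv.2 hmem.1
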